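/- For $p\in M=[0,\tfrac{\pi}{2}]$ let $R_p\subset\mathbb R^2$ be the rhombus of unit side centered at the origin whose diagonals lie on the coordinate axes, with (smaller) angle $p$ at its vertices $(\pm\cos\tfrac p2,0)$ (the other two vertices being $(0,\pm\sin\tfrac p2)$), so that $R_{\pi/2}$ is a square and $R_0$ is a segment. Let $d\mu=\tfrac{2}{\pi}\,dp$ be the uniform probability measure on $M$, and let $$k(p,q)=\operatorname{area}\,(R_p\,\triangle\, R_q),\qquad p,q\in M,$$ be the area of the symmetric difference. For $b>0$ and Borel measurable $f\ge 0$ on $M$ with $\int_M f\,d\mu=1$ define $$U[f](p)=\int_M k(p,q)f(q)\,d\mu(q),\qquad \mathcal E_b[f]=\int_M\Big\{\log f+\frac b2 U[f]\Big\}f\,d\mu\in(-\infty,\infty].$$ A free energy minimizer for $b$ is such a function $g$ with $\mathcal E_b[g]\le\mathcal E_b[f]$ for all such $f$. Then: 1. $k(p,p)=0$ for all $p\in M$, and for all $p\ne q$ in $M$ $$k(p,q)=8\,\frac{\sin^2\frac{|p-q|}4}{\sin\frac{|p-q|}2}\left(\sin^2\frac{p+q}4\,\sin\frac p2\,\sin\frac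 q2+\cos^2\frac{p+q}4\,\cos\frac p2\,\cos\frac q2\right).$$ 2. $k(p,p+\varepsilon)=\varepsilon\left(\sin^4\frac p2+\cos^4\frac p2\right)+O(\varepsilon^2)$, uniformly for $\varepsilon\ge0$ and $p,\,p+\varepsilon\in M$. 3. Free energy minimizers concentrate on the square as $b\to\infty$: if $g_b$ is a free energy minimizer for $b$, then $g_b\,d\mu\rightharpoonup\delta_{\pi/2}$ weakly as $b\to\infty$. More precisely, for any family $(b_i)$ of parameters tending to $\infty$ along a filter (for example a sequence $b_n\to\infty$, or $b\to\infty$ through the reals) and any densities $g_i$ that are eventually free energy minimizers for $b_i$, the probability measures $g_i\,d\mu$ converge weakly to $\delta_{\pi/2}$. -/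

import Mathlib

open Real MeasureTheory Filter Topology
open scoped symmDiff

noncomputable section

/-- The probability densities with respect to `μ`: Borel measurable `f ≥ 0` with `∫ f dμ = 1`. -/
structure Density {M : Type*} [MeasurableSpace M] (μ : Measure M) where
  toFun : M → ℝ
  measurable' : Measurable toFun
  nonneg' : ∀ p, 0 ≤ toFun p
  integral_eq_one' : ∫ p, toFun p ∂μ = 1

/-- The state `f dμ` of a density, as a probability measure. -/
def Density.toProbabilityMeasure {M : Type*} [MeasurableSpace M] {μ : Measure M}
    (f : Density μ) : ProbabilityMeasure M :=
  ⟨μ.withDensity (fun p => ENNReal.ofReal (f.toFun p)), ⟨by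
    have hint : Integrable f.toFun μ :=
      Integrable.of_integral_ne_zero (by rw [f.integral_eq_one']; exact one_ne_zero)
    rw [withDensity_apply _ MeasurableSet.univ, Measure.restrict_univ,
      ← ofReal_integral_eq_lintegral_ofReal hint (ae_of_all _ f.nonneg'),
      f.integral_eq_one', ENNReal.ofReal_one]⟩⟩

/-- The potential `U[f](p) = ∫ k(p,q) f(q) dμ(q)`. -/
def potential {M : Type*} [MeasurableSpace M] {μ : Measure M} (k : M → M → ℝ)
    (f : Density μ) (p : M) : ℝ :=
  ∫ q, k p q * f.toFun q ∂μ

/-- The integrand `(log f + (b/2) U[f]) f` of the free energy (with `0 log 0 = 0`). -/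
def freeEnergyIntegrand {M : Type*} [MeasurableSpace M] {μ : Measure M} (k : M → M → ℝ) (b : ℝ)
    (f : Density μ) (p : M) : ℝ :=
  (log (f.toFun p) + b / 2 * potential k f p) * f.toFun p

open Classical in
/-- The free energy `E_b[f] = ∫ (log f + (b/2) U[f]) f dμ`. For `k ≥ 0`, `b > 0` and `μ` finite the
integrand is bounded below, so the integral always exists in `(-∞, ∞]`; it is `+∞` exactly when the
integrand is not integrable. -/
def freeEnergy {M : Type*} [MeasurableSpace M] {μ : Measure M} (k : M → M → ℝ) (b : ℝ)
    (f : Density μ) : EReal :=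
  if Integrable (freeEnergyIntegrand k b f) μ
    then ((∫ p, freeEnergyIntegrand k b f p ∂μ : ℝ) : EReal)
    else ⊤

/-- `g` minimizes the free energy `E_b` among all densities. -/
def IsFreeEnergyMinimizer {M : Type*} [MeasurableSpace M] {μ : Measure M} (k : M → M → ℝ) (b : ℝ)
    (g : Density μ) : Prop :=
  ∀ f : Density μ, freeEnergy k b g ≤ freeEnergy k b f

/-- The configuration space `[0, π/2]` of smaller angles, with the metric and the Borel sets
of the real line. -/
abbrev RhombusAngle : Type := Set.Icc (0 : ℝ) (π / 2)

/-- The uniform measure `dμ = (2/π) dp` on `[0, π/2]`. -/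
def uniformAngle : Measure RhombusAngle :=
  ENNReal.ofReal (2 / π) • Measure.comap (Subtype.val : RhombusAngle → ℝ) volume

/-- The parameter `π/2` of the unit square. -/
def squareAngle : RhombusAngle := ⟨π / 2, by constructor <;> linarith [pi_pos]⟩

/-- The rhombus of unit side with angle `p` at its vertices on the `x`-axis, centred at the origin,
with diagonals on the axes: a closed set in the plane (a segment for `p = 0`). -/
def rhombus (p : ℝ) : Set (ℝ × ℝ) :=
  convexHull ℝ {(cos (p / 2), 0), (-cos (p / 2), 0), (0, sin (p / 2)), (0, -sin (p / 2))}

/-- The interaction kernel: the area of the symmetric difference of two aligned rhombi. -/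
def rhombusKernel (p q : RhombusAngle) : ℝ :=
  (volume (rhombus p ∆ rhombus q)).toReal

end

/-! The kernel formulas come from slicing: up to a null set an aligned rhombus is the region under a
piecewise affine chord profile, and the profiles of two rhombi cross once, so the area is an
elementary integral. Half-angle identities turn it into `rhombusKernel_eq`, a function of the
difference and the mean of the angles, from which the expansion on the diagonal follows.

For concentration, the slope `sin^4 (p/2) + cos^4 (p/2) = (1 + cos^2 p)/2` of the kernel on the
diagonal is least, namely 1/2, at the square. The kernel dominates `|Φ p - Φ q|` globally, where `Φ'
= φ = 1/2 + (π/2 - s)^2/100` (`abs_angleGauge_sub_le_rhombusKernel`). For such a one-dimensional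
kernel the interaction of a state `ν = f dμ` is `π ∫ φ F G dμ`, with `F s = ν(Iic s)` and `G s =
ν(Ici s)` (`integral_abs_sub_prod`). The tangent line inequality `x log x ≥ x (log y + 1) - y` at `y
= b (π/2) φ F G` cancels the interaction exactly and leaves the `ν`-integral of `log y + 1`. Since
`F` and `G` are essentially uniform on `[0,1]` under `ν`, their logarithms have mean at least -1, so
the energy is at least `log b + log (π/2) - 1 + ∫ log φ dν` (`le_integral_freeEnergyIntegrand`).

Equality for constant `φ = 1/2` would mean `F' = (b/2) F (1 - F)`, a logistic law. Logistic profiles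
of width `O(1/b)` placed at the square come within `o(1)` of the bound with `φ` replaced by 1/2
(`exists_freeEnergy_le`). Comparing the two bounds, a minimizer satisfies `∫ (log φ + log 2) dν →
0`. This integrand is nonnegative and vanishes only at the square, which forces weak convergence to
the Dirac mass. -/

/-! ### Area of the symmetric difference of two rhombi with common axes -/

/-- A rhombus with half-diagonals `a > 0` and `c ≥ 0` on the coordinate axes. -/
lemma mem_convexHull_rhombus_iff {a c : ℝ} (ha : 0 < a) (hc : 0 ≤ c) (z : ℝ × ℝ) :
    z ∈ convexHull ℝ ({(a, 0), (-a, 0), (0, c), (0, -c)} : Set (ℝ × ℝ)) ↔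
      |z.1| ≤ a ∧ |z.2| ≤ c * (1 - |z.1| / a) := by
  constructor
  · intro hz
    have hconv : Convex ℝ {z : ℝ × ℝ | |z.1| ≤ a ∧ |z.2| + c / a * |z.1| ≤ c} := by
      have h1 : ConvexOn ℝ Set.univ (fun z : ℝ × ℝ => |z.1|) := by
        simpa [Function.comp_def] using
          (convexOn_norm (E := ℝ) convex_univ).comp_linearMap (LinearMap.fst ℝ ℝ ℝ)
      have h2 : ConvexOn ℝ Set.univ (fun z : ℝ × ℝ => |z.2|) := by
        simpa [Function.comp_def] using
          (convexOn_norm (E := ℝ) convex_univ).comp_linearMap (LinearMap.snd ℝ ℝ ℝ)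
      have h3 := (h2.add (h1.smul (div_nonneg hc ha.le))).convex_le c
      have h4 := h1.convex_le a
      have h5 := h4.inter h3
      convert h5 using 1
      ext z
      simp
    have hmem := convexHull_min (s := ({(a, 0), (-a, 0), (0, c), (0, -c)} : Set (ℝ × ℝ)))
      (t := {z : ℝ × ℝ | |z.1| ≤ a ∧ |z.2| + c / a * |z.1| ≤ c}) (by
        rintro w (rfl | rfl | rfl | rfl) <;>
          simp [abs_of_pos ha, abs_of_nonneg hc, ha.le, ha.ne']) hconv hz
    refine ⟨hmem.1, ?_⟩
    have := hmem.2
    have e : c / a * |z.1| = c * (|z.1| / a) := by ring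
    rw [e] at this
    linarith
  · rintro ⟨h1, h2⟩
    obtain ⟨x, y⟩ := z
    simp only at h1 h2
    have hK := convex_convexHull ℝ ({(a, 0), (-a, 0), (0, c), (0, -c)} : Set (ℝ × ℝ))
    set K := convexHull ℝ ({(a, 0), (-a, 0), (0, c), (0, -c)} : Set (ℝ × ℝ)) with hKdef
    have hsub := subset_convexHull ℝ ({(a, 0), (-a, 0), (0, c), (0, -c)} : Set (ℝ × ℝ))
    -- The point is a convex combination, with weight `|x| / a`, of a horizontal vertex and a point
    -- of the vertical diagonal.
    have hx : ∃ w : ℝ, (w, (0 : ℝ)) ∈ K ∧ x = |x| / a * w := by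
      rcases le_total 0 x with h | h
      · exact ⟨a, hsub (by simp), by rw [abs_of_nonneg h]; field_simp⟩
      · exact ⟨-a, hsub (by simp), by rw [abs_of_nonpos h]; field_simp⟩
    obtain ⟨w, hw, hxw⟩ := hx
    have hvert : ∀ t : ℝ, |t| ≤ c → ((0 : ℝ), t) ∈ K := by
      intro t ht
      rcases hc.eq_or_lt with rfl | hc
      · have : t = 0 := by simpa using ht
        subst this
        exact hsub (by simp)
      · have hp : ((0 : ℝ), c) ∈ K := hsub (by simp)
        have hm : ((0 : ℝ), -c) ∈ K := hsub (by simp)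
        have ht' := abs_le.1 ht
        have := hK hp hm (a := (c + t) / (2 * c)) (b := (c - t) / (2 * c))
          (div_nonneg (by linarith) (by linarith)) (div_nonneg (by linarith) (by linarith))
          (by field_simp; ring)
        convert this using 1
        ext
        · simp
        · simp
          field_simp
          ring
    set α := |x| / a with hα
    have hα0 : 0 ≤ α := by positivity
    have hα1 : α ≤ 1 := (div_le_one ha).2 h1
    rcases hα1.eq_or_lt with h | h
    · have hy : y = 0 := by simpa [h] using h2
      rw [hxw, h, hy, one_mul]
      exact hw
    · have hpos : 0 < 1 - α := by linarith
      have := hK hw (hvert (y / (1 - α)) (by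
        rw [abs_div, abs_of_pos hpos, div_le_iff₀ hpos]; exact h2)) hα0 hpos.le (by ring)
      convert this using 1
      ext
      · simpa using hxw
      · simp
        field_simp

/-- The half-length of the vertical chord at `|x| = r` of the rhombus with half-diagonals `a` and `c`. -/
noncomputable def rhombusProfile (a c r : ℝ) : ℝ := max 0 (c * (1 - r / a))

lemma rhombusProfile_nonneg (a c r : ℝ) : 0 ≤ rhombusProfile a c r := le_max_left _ _

lemma continuous_rhombusProfile (a c : ℝ) : Continuous (rhombusProfile a c) := by
  unfold rhombusProfile
  fun_prop

/-- Truncating the profile at zero only adds the part of the horizontal axis beyond the vertices,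
which is null. -/
lemma convexHull_rhombus_ae_eq {a c : ℝ} (ha : 0 < a) (hc : 0 ≤ c) :
    (convexHull ℝ ({(a, 0), (-a, 0), (0, c), (0, -c)} : Set (ℝ × ℝ))) =ᵐ[volume]
      {z : ℝ × ℝ | |z.2| ≤ rhombusProfile a c |z.1|} := by
  have hnull : ∀ᵐ z : ℝ × ℝ, z.2 ≠ 0 := by
    have h : (volume : Measure ℝ) {y : ℝ | ¬ y ≠ 0} = 0 := by simp
    exact Measure.quasiMeasurePreserving_snd.ae h
  filter_upwards [hnull] with z hz
  refine propext ?_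
  change z ∈ convexHull ℝ _ ↔ |z.2| ≤ rhombusProfile a c |z.1|
  rw [mem_convexHull_rhombus_iff ha hc]
  have hpos : 0 < |z.2| := abs_pos.2 hz
  unfold rhombusProfile
  rw [le_max_iff]
  constructor
  · rintro ⟨-, h⟩
    exact Or.inr h
  · rintro (h | h)
    · exact absurd h (not_le.2 hpos)
    · refine ⟨?_, h⟩
      by_contra! hlt
      have h1 : 1 < |z.1| / a := (one_lt_div ha).2 hlt
      nlinarith

lemma volume_Icc_symmDiff_Icc {a b : ℝ} (ha : 0 ≤ a) (hb : 0 ≤ b) :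
    volume ({y : ℝ | |y| ≤ a} ∆ {y : ℝ | |y| ≤ b}) = ENNReal.ofReal (2 * |a - b|) := by
  have key : ∀ {a b : ℝ}, 0 ≤ a → a ≤ b →
      volume ({y : ℝ | |y| ≤ a} ∆ {y : ℝ | |y| ≤ b}) = ENNReal.ofReal (2 * |a - b|) := by
    intro a b ha hab
    have e : ∀ c : ℝ, {y : ℝ | |y| ≤ c} = Set.Icc (-c) c := by
      intro c; ext y; simp [abs_le]
    have hs : Set.Icc (-a) a ⊆ Set.Icc (-b) b := Set.Icc_subset_Icc (by linarith) hab
    rw [e, e, symmDiff_of_le hs, measure_sdiff hs measurableSet_Icc.nullMeasurableSet (by simp),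
      Real.volume_Icc, Real.volume_Icc, ← ENNReal.ofReal_sub _ (by linarith),
      abs_of_nonpos (by linarith)]
    congr 1
    ring
  rcases le_total a b with h | h
  · exact key ha h
  · rw [symmDiff_comm, abs_sub_comm]
    exact key hb h

lemma volume_convexHull_rhombus_symmDiff {a c a' c' : ℝ} (ha : 0 < a) (hc : 0 ≤ c)
    (ha' : 0 < a') (hc' : 0 ≤ c') :
    (volume ((convexHull ℝ ({(a, 0), (-a, 0), (0, c), (0, -c)} : Set (ℝ × ℝ))) ∆
      (convexHull ℝ ({(a', 0), (-a', 0), (0, c'), (0, -c')} : Set (ℝ × ℝ))))).toReal =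
      4 * ∫ r in Set.Ioi (0 : ℝ), |rhombusProfile a c r - rhombusProfile a' c' r| := by
  have hmeas : ∀ a c : ℝ, MeasurableSet {z : ℝ × ℝ | |z.2| ≤ rhombusProfile a c |z.1|} :=
    fun a c => measurableSet_le (by fun_prop)
      ((continuous_rhombusProfile a c).measurable.comp (by fun_prop))
  rw [measure_congr ((convexHull_rhombus_ae_eq ha hc).symmDiff (convexHull_rhombus_ae_eq ha' hc')),
    Measure.volume_eq_prod, Measure.prod_apply ((hmeas a c).symmDiff (hmeas a' c'))]
  have hslice : ∀ x : ℝ, volume (Prod.mk x ⁻¹' ({z : ℝ × ℝ | |z.2| ≤ rhombusProfile a c |z.1|} ∆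
      {z : ℝ × ℝ | |z.2| ≤ rhombusProfile a' c' |z.1|})) =
      ENNReal.ofReal (2 * |rhombusProfile a c |x| - rhombusProfile a' c' (|x|)|) := fun x =>
    volume_Icc_symmDiff_Icc (rhombusProfile_nonneg a c |x|) (rhombusProfile_nonneg a' c' |x|)
  simp_rw [hslice]
  have hcont : Continuous fun x : ℝ =>
      2 * |rhombusProfile a c |x| - rhombusProfile a' c' (|x|)| := by
    have := continuous_rhombusProfile a c
    have := continuous_rhombusProfile a' c'
    fun_prop
  rw [← integral_eq_lintegral_of_nonneg_ae (ae_of_all _ fun x => by positivity)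
    hcont.aestronglyMeasurable, integral_const_mul,
    integral_comp_abs (f := fun r => |rhombusProfile a c r - rhombusProfile a' c' r|)]
  ring

lemma intervalIntegral_affine (α β u v : ℝ) :
    ∫ r in u..v, (α + β * r) = α * (v - u) + β * ((v ^ 2 - u ^ 2) / 2) := by
  rw [intervalIntegral.integral_add (by simp) (by
    apply Continuous.intervalIntegrable; fun_prop), intervalIntegral.integral_const,
    intervalIntegral.integral_const_mul, integral_id]
  simp [mul_comm]

lemma integral_abs_rhombusProfile_sub {a c a' c' : ℝ} (ha' : 0 < a') (haa : a' < a) (hc : 0 ≤ c)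
    (hcc : c < c') :
    ∫ r in Set.Ioi (0 : ℝ), |rhombusProfile a c r - rhombusProfile a' c' r| =
      (c * c' * (a - a') ^ 2 + a * a' * (c' - c) ^ 2) / (2 * (a * c' - a' * c)) := by
  have ha : 0 < a := ha'.trans haa
  have hc' : 0 < c' := hc.trans_lt hcc
  have hD : 0 < a * c' - a' * c := by nlinarith
  set f : ℝ → ℝ := fun r => |rhombusProfile a c r - rhombusProfile a' c' r| with hf
  have hcont : Continuous f := by
    have := continuous_rhombusProfile a c
    have := continuous_rhombusProfile a' c'
    simp only [hf]
    fun_prop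
  have hzero : ∀ r ∈ Set.Ioi (0 : ℝ) \ Set.Ioc 0 a, f r = 0 := by
    intro r hr
    have hr1 : a < r := by
      by_contra! h
      exact hr.2 ⟨hr.1, h⟩
    have e1 : rhombusProfile a c r = 0 := max_eq_left
      (mul_nonpos_of_nonneg_of_nonpos hc (by linarith [(one_lt_div ha).2 hr1]))
    have e2 : rhombusProfile a' c' r = 0 := max_eq_left
      (mul_nonpos_of_nonneg_of_nonpos hc'.le (by linarith [(one_lt_div ha').2 (haa.trans hr1)]))
    simp [hf, e1, e2]
  rw [setIntegral_eq_of_subset_of_forall_sdiff_eq_zero measurableSet_Ioi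
    Set.Ioc_subset_Ioi_self hzero, ← intervalIntegral.integral_of_le ha.le]
  -- The abscissa where the two edges cross: the primed profile is higher before `x`, the other one
  -- between `x` and `a'`, and beyond `a'` only the latter is left.
  set x := a * a' * (c' - c) / (a * c' - a' * c) with hx
  have hx0 : 0 ≤ x := div_nonneg (by nlinarith [mul_pos ha ha']) hD.le
  have hxa : x ≤ a' := by
    rw [hx, div_le_iff₀ hD]
    nlinarith [mul_nonneg (mul_nonneg ha'.le hc) (sub_nonneg.2 haa.le)]
  have hxD : x * (a * c' - a' * c) = a * a' * (c' - c) := div_mul_cancel₀ _ hD.ne'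
  have hxs : (c' / a' - c / a) * x = c' - c := by
    field_simp
    linear_combination hxD
  have hprof : ∀ r, r ≤ a → rhombusProfile a c r = c - c / a * r := fun r hr => by
    have : r / a ≤ 1 := (div_le_one ha).2 hr
    rw [rhombusProfile, max_eq_right (mul_nonneg hc (by linarith))]
    ring
  have hprof' : ∀ r, r ≤ a' → rhombusProfile a' c' r = c' - c' / a' * r := fun r hr => by
    have : r / a' ≤ 1 := (div_le_one ha').2 hr
    rw [rhombusProfile, max_eq_right (mul_nonneg hc'.le (by linarith))]
    ring
  have hdiff : ∀ r, (c' - c' / a' * r) - (c - c / a * r) =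
      (a * c' - a' * c) / (a * a') * (x - r) := fun r => by
    field_simp
    linear_combination -hxD
  have hcoef : 0 < (a * c' - a' * c) / (a * a') := by positivity
  have i1 : ∫ r in (0 : ℝ)..x, f r = ∫ r in (0 : ℝ)..x, ((c' - c) + (c / a - c' / a') * r) := by
    refine intervalIntegral.integral_congr fun r hr => ?_
    rw [Set.uIcc_of_le hx0] at hr
    simp only [hf]
    rw [hprof r (by linarith [hr.2]), hprof' r (hr.2.trans hxa), abs_sub_comm, abs_of_nonneg]
    · ring
    · rw [hdiff]
      exact mul_nonneg hcoef.le (by linarith [hr.2])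
  have i2 : ∫ r in x..a', f r = ∫ r in x..a', ((c - c') + (c' / a' - c / a) * r) := by
    refine intervalIntegral.integral_congr fun r hr => ?_
    rw [Set.uIcc_of_le hxa] at hr
    simp only [hf]
    rw [hprof r (by linarith [hr.2]), hprof' r hr.2, abs_sub_comm, abs_of_nonpos]
    · ring
    · rw [hdiff]
      exact mul_nonpos_of_nonneg_of_nonpos hcoef.le (by linarith [hr.1])
  have i3 : ∫ r in a'..a, f r = ∫ r in a'..a, (c + (-(c / a)) * r) := by
    refine intervalIntegral.integral_congr fun r hr => ?_
    rw [Set.uIcc_of_le haa.le] at hr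
    have e2 : rhombusProfile a' c' r = 0 := max_eq_left
      (mul_nonpos_of_nonneg_of_nonpos hc'.le (by linarith [(one_le_div ha').2 hr.1]))
    have := rhombusProfile_nonneg a c r
    simp only [hf]
    rw [e2, sub_zero, abs_of_nonneg this, hprof r hr.2]
    ring
  rw [← intervalIntegral.integral_add_adjacent_intervals (b := x) (hcont.intervalIntegrable _ _)
    (hcont.intervalIntegrable _ _), ← intervalIntegral.integral_add_adjacent_intervals (b := a')
    (hcont.intervalIntegrable x a') (hcont.intervalIntegrable _ _), i1, i2, i3,
    intervalIntegral_affine, intervalIntegral_affine, intervalIntegral_affine,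
    eq_div_iff (by positivity)]
  have hconst : (c - c') * a' + (c' / a' - c / a) * (a' ^ 2 / 2) + c * (a - a') +
      -(c / a) * ((a ^ 2 - a' ^ 2) / 2) = (a * c - a' * c') / 2 := by
    field_simp
    ring
  linear_combination 2 * (a * c' - a' * c) * hconst - 2 * (a * c' - a' * c) * x * hxs +
    2 * (c' - c) * hxD

/-! ### Closed forms of the kernel -/

namespace RhombusAngle

lemma half_mem (p : RhombusAngle) : 0 ≤ (p : ℝ) / 2 ∧ (p : ℝ) / 2 ≤ π / 4 := by
  have := p.2.1
  have := p.2.2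
  constructor <;> linarith

lemma cos_half_pos (p : RhombusAngle) : 0 < cos ((p : ℝ) / 2) :=
  cos_pos_of_mem_Ioo ⟨by linarith [pi_pos, (half_mem p).1], by linarith [pi_pos, (half_mem p).2]⟩

lemma sin_half_nonneg (p : RhombusAngle) : 0 ≤ sin ((p : ℝ) / 2) :=
  sin_nonneg_of_nonneg_of_le_pi (half_mem p).1 (by linarith [pi_pos, (half_mem p).2])

end RhombusAngle

open RhombusAngle

lemma rhombusKernel_self (p : RhombusAngle) : rhombusKernel p p = 0 := by
  simp [rhombusKernel]

lemma rhombusKernel_comm (p q : RhombusAngle) : rhombusKernel p q = rhombusKernel q p := by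
  simp [rhombusKernel, symmDiff_comm]

/-- The smaller angle has the longer horizontal and the shorter vertical diagonal, so the profile
integral applies; sum-to-product identities extract the common factor `sin ((q - p) / 4) ^ 2`. -/
lemma rhombusKernel_eq_of_lt {p q : RhombusAngle} (hpq : (p : ℝ) < q) :
    rhombusKernel p q =
      8 * (sin (((q : ℝ) - p) / 4) ^ 2 / sin (((q : ℝ) - p) / 2)) *
        (sin (((p : ℝ) + q) / 4) ^ 2 * sin ((p : ℝ) / 2) * sin ((q : ℝ) / 2) +
          cos (((p : ℝ) + q) / 4) ^ 2 * cos ((p : ℝ) / 2) * cos ((q : ℝ) / 2)) := by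
  have hp := half_mem p
  have hq := half_mem q
  have hcos : cos ((q : ℝ) / 2) < cos ((p : ℝ) / 2) :=
    cos_lt_cos_of_nonneg_of_le_pi hp.1 (by linarith [pi_pos]) (by linarith)
  have hsin : sin ((p : ℝ) / 2) < sin ((q : ℝ) / 2) :=
    sin_lt_sin_of_lt_of_le_pi_div_two (by linarith [pi_pos]) (by linarith [pi_pos]) (by linarith)
  have h := volume_convexHull_rhombus_symmDiff (cos_half_pos p) (sin_half_nonneg p)
    (cos_half_pos q) (sin_half_nonneg q)
  rw [integral_abs_rhombusProfile_sub (cos_half_pos q) hcos (sin_half_nonneg p) hsin] at h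
  have e1 : cos ((p : ℝ) / 2) - cos ((q : ℝ) / 2) =
      2 * sin (((p : ℝ) + q) / 4) * sin (((q : ℝ) - p) / 4) := by
    rw [cos_sub_cos, show ((p : ℝ) / 2 - q / 2) / 2 = -(((q : ℝ) - p) / 4) by ring, sin_neg,
      show ((p : ℝ) / 2 + q / 2) / 2 = ((p : ℝ) + q) / 4 by ring]
    ring
  have e2 : sin ((q : ℝ) / 2) - sin ((p : ℝ) / 2) =
      2 * sin (((q : ℝ) - p) / 4) * cos (((p : ℝ) + q) / 4) := by
    rw [sin_sub_sin, show ((q : ℝ) / 2 - p / 2) / 2 = ((q : ℝ) - p) / 4 by ring,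
      show ((q : ℝ) / 2 + p / 2) / 2 = ((p : ℝ) + q) / 4 by ring]
  have e3 : cos ((p : ℝ) / 2) * sin ((q : ℝ) / 2) - cos ((q : ℝ) / 2) * sin ((p : ℝ) / 2) =
      sin (((q : ℝ) - p) / 2) := by
    rw [sub_div, sin_sub]
    ring
  rw [e1, e2, e3] at h
  refine h.trans ?_
  have hs : sin (((q : ℝ) - p) / 2) ≠ 0 :=
    (sin_pos_of_pos_of_lt_pi (by linarith) (by linarith [pi_pos])).ne'
  field_simp
  ring

/-- The closed form of `rhombusKernel` in terms of the difference and the mean of the angles. -/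
lemma rhombusKernel_eq (p q : RhombusAngle) :
    rhombusKernel p q = 2 * tan (|(p : ℝ) - q| / 4) *
      (cos (|(p : ℝ) - q| / 2) + cos (((p : ℝ) + q) / 2) ^ 2) := by
  have key : ∀ p q : RhombusAngle, (p : ℝ) < q → rhombusKernel p q =
      2 * tan (((q : ℝ) - p) / 4) * (cos (((q : ℝ) - p) / 2) + cos (((p : ℝ) + q) / 2) ^ 2) := by
    intro p q hpq
    have hp := half_mem p
    have hq := half_mem q
    rw [rhombusKernel_eq_of_lt hpq]
    have hs : 0 < sin (((q : ℝ) - p) / 4) :=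
      sin_pos_of_pos_of_lt_pi (by linarith) (by linarith [pi_pos])
    have hc : 0 < cos (((q : ℝ) - p) / 4) :=
      cos_pos_of_mem_Ioo ⟨by linarith [pi_pos], by linarith [pi_pos]⟩
    have e1 : sin (((q : ℝ) - p) / 2) = 2 * sin (((q : ℝ) - p) / 4) * cos (((q : ℝ) - p) / 4) := by
      rw [← sin_two_mul]; ring_nf
    have e2 : cos (((p : ℝ) + q) / 2) = 2 * cos (((p : ℝ) + q) / 4) ^ 2 - 1 := by
      rw [← cos_two_mul]; ring_nf
    have e3 : cos (((p : ℝ) + q) / 2) =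
        cos ((p : ℝ) / 2) * cos ((q : ℝ) / 2) - sin ((p : ℝ) / 2) * sin ((q : ℝ) / 2) := by
      rw [← cos_add]; ring_nf
    have e4 : cos (((q : ℝ) - p) / 2) =
        cos ((p : ℝ) / 2) * cos ((q : ℝ) / 2) + sin ((p : ℝ) / 2) * sin ((q : ℝ) / 2) := by
      rw [← cos_sub, ← cos_neg]; ring_nf
    have e5 := sin_sq_add_cos_sq (((p : ℝ) + q) / 4)
    have e6 : sin (((p : ℝ) + q) / 4) ^ 2 * sin ((p : ℝ) / 2) * sin ((q : ℝ) / 2) +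
        cos (((p : ℝ) + q) / 4) ^ 2 * cos ((p : ℝ) / 2) * cos ((q : ℝ) / 2) =
        (cos (((q : ℝ) - p) / 2) + cos (((p : ℝ) + q) / 2) ^ 2) / 2 := by
      have hC : cos (((p : ℝ) + q) / 4) ^ 2 = (1 + cos (((p : ℝ) + q) / 2)) / 2 := by linarith
      have hS : sin (((p : ℝ) + q) / 4) ^ 2 = (1 - cos (((p : ℝ) + q) / 2)) / 2 := by linarith
      rw [hC, hS, e4]
      linear_combination -(1 / 2) * cos (((p : ℝ) + q) / 2) * e3
    rw [e6, e1, tan_eq_sin_div_cos]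
    field_simp
    ring
  rcases lt_trichotomy (p : ℝ) q with h | h | h
  · rw [key p q h, abs_of_neg (by linarith), neg_sub]
  · have : p = q := Subtype.ext h
    subst this
    simp [rhombusKernel_self]
  · rw [rhombusKernel_comm, key q p h, abs_of_pos (by linarith), add_comm (q : ℝ)]

lemma rhombusKernel_formula {p q : RhombusAngle} (hpq : p ≠ q) :
    rhombusKernel p q =
      8 * (sin (|(p : ℝ) - q| / 4) ^ 2 / sin (|(p : ℝ) - q| / 2)) *
        (sin (((p : ℝ) + q) / 4) ^ 2 * sin ((p : ℝ) / 2) * sin ((q : ℝ) / 2) +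
          cos (((p : ℝ) + q) / 4) ^ 2 * cos ((p : ℝ) / 2) * cos ((q : ℝ) / 2)) := by
  rcases lt_or_gt_of_ne (fun h => hpq (Subtype.ext h) : (p : ℝ) ≠ q) with h | h
  · rw [rhombusKernel_eq_of_lt h, abs_of_neg (by linarith), neg_sub]
  · rw [rhombusKernel_comm, rhombusKernel_eq_of_lt h, abs_of_pos (by linarith),
      add_comm (q : ℝ)]
    ring

/-- The tangent form is also valid on the diagonal, and its argument stays within `[0, π/8]`, away
from the poles. -/
lemma continuous_rhombusKernel : Continuous fun z : RhombusAngle × RhombusAngle =>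
    rhombusKernel z.1 z.2 := by
  simp_rw [rhombusKernel_eq]
  have h : ∀ z : RhombusAngle × RhombusAngle, cos (|(z.1 : ℝ) - z.2| / 4) ≠ 0 := by
    intro z
    have h1 := z.1.2
    have h2 := z.2.2
    have h3 : |(z.1 : ℝ) - z.2| ≤ π / 2 := abs_le.2 ⟨by linarith [h1.1, h2.2], by
      linarith [h1.2, h2.1]⟩
    exact (cos_pos_of_mem_Ioo ⟨by linarith [abs_nonneg ((z.1 : ℝ) - z.2), pi_pos],
      by linarith [pi_pos]⟩).ne'
  simp_rw [tan_eq_sin_div_cos]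
  fun_prop (disch := exact h _)

/-! ### Expansion of the kernel at the diagonal -/

lemma tan_sub_self_le {t : ℝ} (h0 : 0 ≤ t) (h1 : t ≤ π / 8) : t ≤ tan t ∧ tan t - t ≤ t ^ 2 := by
  have ht : t ≤ 1 / 2 := by linarith [pi_lt_four]
  have hc : 1 / 2 ≤ cos t := by nlinarith [one_sub_sq_div_two_le_cos (x := t)]
  refine ⟨le_tan h0 (by linarith [pi_pos]), ?_⟩
  rw [tan_eq_sin_div_cos, sub_le_iff_le_add, div_le_iff₀ (by linarith)]
  have h2 := sin_le h0
  have h3 := one_sub_sq_div_two_le_cos (x := t)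
  have : t ≤ (t ^ 2 + t) * (1 - t ^ 2 / 2) := by
    have : (t ^ 2 + t) * (1 - t ^ 2 / 2) - t = t ^ 2 * (1 - t / 2 - t ^ 2 / 2) := by ring
    have : 0 ≤ t ^ 2 * (1 - t / 2 - t ^ 2 / 2) := mul_nonneg (sq_nonneg t) (by nlinarith)
    linarith
  nlinarith [mul_le_mul_of_nonneg_left h3 (by positivity : 0 ≤ t ^ 2 + t)]

lemma sin_half_pow_four_add_cos_half_pow_four (x : ℝ) :
    sin (x / 2) ^ 4 + cos (x / 2) ^ 4 = (1 + cos x ^ 2) / 2 := by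
  have h1 : cos x = 2 * cos (x / 2) ^ 2 - 1 := by rw [← cos_two_mul]; ring_nf
  have h2 : sin (x / 2) ^ 2 = 1 - cos (x / 2) ^ 2 := by linarith [sin_sq_add_cos_sq (x / 2)]
  rw [h1, show sin (x / 2) ^ 4 = (sin (x / 2) ^ 2) ^ 2 by ring, h2]
  ring

lemma abs_rhombusKernel_sub_le {p q : RhombusAngle} {ε : ℝ} (hε : 0 ≤ ε) (hq : (q : ℝ) = p + ε) :
    |rhombusKernel p q - ε * (sin ((p : ℝ) / 2) ^ 4 + cos ((p : ℝ) / 2) ^ 4)| ≤ 2 * ε ^ 2 := by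
  have hp := p.2
  have hq2 := q.2
  have hεpi : ε ≤ π / 2 := by linarith [hp.1, hq2.2]
  have hε2 : ε ≤ 2 := by linarith [pi_lt_four]
  obtain ⟨t1, t2⟩ := tan_sub_self_le (t := ε / 4) (by linarith) (by linarith)
  have e0 : |(p : ℝ) - q| = ε := by rw [hq, abs_sub_comm]; simpa using hε
  have e1 := sin_half_pow_four_add_cos_half_pow_four (p : ℝ)
  rw [rhombusKernel_eq, e0, e1]
  set m : ℝ := ((p : ℝ) + q) / 2 with hm
  have hmp : m = p + ε / 2 := by rw [hm, hq]; ring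
  have c1 : |cos m - cos p| ≤ ε / 2 := by
    have := abs_cos_sub_cos_le m p
    rwa [hmp, add_sub_cancel_left, abs_of_nonneg (by linarith : 0 ≤ ε / 2), ← hmp] at this
  have c2 : |cos m ^ 2 - cos p ^ 2| ≤ ε := by
    rw [sq_sub_sq, abs_mul]
    have : |cos m + cos p| ≤ 2 := (abs_add_le _ _).trans (by
      linarith [abs_cos_le_one m, abs_cos_le_one p])
    nlinarith [abs_nonneg (cos m - cos p)]
  have c3 := one_sub_sq_div_two_le_cos (x := ε / 2)
  have c4 := cos_le_one (ε / 2)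
  have c5 := cos_sq_le_one m
  have c6 := sq_nonneg (cos m)
  have c7 : 0 ≤ cos (ε / 2) := by nlinarith
  obtain ⟨c8, c9⟩ := abs_le.1 c2
  -- The first term is the error of linearizing the tangent, the second that of moving the cosines
  -- to `0` and `p`; each is of order `ε ^ 2`.
  have hsplit : 2 * tan (ε / 4) * (cos (ε / 2) + cos m ^ 2) - ε * ((1 + cos p ^ 2) / 2) =
      2 * (tan (ε / 4) - ε / 4) * (cos (ε / 2) + cos m ^ 2) +
      ε / 2 * (cos (ε / 2) - 1 + (cos m ^ 2 - cos p ^ 2)) := by ring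
  have d1 : 0 ≤ 2 * (tan (ε / 4) - ε / 4) * (cos (ε / 2) + cos m ^ 2) := by
    apply mul_nonneg <;> linarith
  have d2 : 2 * (tan (ε / 4) - ε / 4) * (cos (ε / 2) + cos m ^ 2) ≤ 2 * (ε / 4) ^ 2 * 2 := by
    apply mul_le_mul <;> nlinarith
  rw [hsplit, abs_le]
  constructor <;> nlinarith

/-! ### A one-dimensional lower bound for the kernel -/

/-- A primitive of `1 / 2 + (π / 2 - s) ^ 2 / 100`. -/
noncomputable def angleGauge (s : ℝ) : ℝ := s / 2 - (π / 2 - s) ^ 3 / 300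

/-- The derivative of `angleGauge`. -/
noncomputable def angleGaugeDeriv (s : ℝ) : ℝ := 1 / 2 + (π / 2 - s) ^ 2 / 100

lemma hasDerivAt_angleGauge (s : ℝ) : HasDerivAt angleGauge (angleGaugeDeriv s) s := by
  have h := ((hasDerivAt_id s).div_const 2).sub
    ((((hasDerivAt_id s).const_sub (π / 2)).pow 3).div_const 300)
  refine h.congr_deriv ?_
  simp only [angleGaugeDeriv, id]
  push_cast
  ring

lemma angleGaugeDeriv_pos (s : ℝ) : 0 < angleGaugeDeriv s := by
  unfold angleGaugeDeriv; positivity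

lemma continuous_angleGaugeDeriv : Continuous angleGaugeDeriv := by
  unfold angleGaugeDeriv; fun_prop

/-- In distances from the square the kernel is `2 tan ((A - B) / 4) (cos x + sin n ^ 2)`, with `x`
half the difference and `n` the mean of `A` and `B`. As `x ≤ n`, the loss `1 - cos x` is outweighed
by `sin n ^ 2`, with a surplus quadratic in `A`. The weight 1/100 in the gauge is small enough for
this surplus to cover. -/
lemma abs_angleGauge_sub_le_rhombusKernel (p q : RhombusAngle) :
    |angleGauge p - angleGauge q| ≤ rhombusKernel p q := by
  have key : ∀ p q : RhombusAngle, (p : ℝ) ≤ q →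
      |angleGauge p - angleGauge q| ≤ rhombusKernel p q := by
    intro p q hpq
    rw [rhombusKernel_eq, abs_sub_comm (p : ℝ), abs_of_nonneg (sub_nonneg.2 hpq)]
    have hp := p.2
    have hq := q.2
    set A := π / 2 - (p : ℝ) with hA
    set B := π / 2 - (q : ℝ) with hB
    have hB0 : 0 ≤ B := by linarith [hq.2]
    have hBA : B ≤ A := by linarith
    have hA2 : A ≤ π / 2 := by linarith [hp.1]
    have hpA : (p : ℝ) = π / 2 - A := by rw [hA]; ring
    have hqB : (q : ℝ) = π / 2 - B := by rw [hB]; ring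
    have hεe : (q : ℝ) - p = A - B := by rw [hA, hB]; ring
    have hme : ((p : ℝ) + q) / 2 = π / 2 - (A + B) / 2 := by rw [hA, hB]; ring
    rw [hεe, hme, cos_pi_div_two_sub]
    have hg : |angleGauge p - angleGauge q| =
        (A - B) / 2 + (A - B) * (A ^ 2 + A * B + B ^ 2) / 300 := by
      rw [abs_sub_comm, abs_of_nonneg]
      · simp only [angleGauge, hpA, hqB]
        ring
      · have : angleGauge q - angleGauge p =
            (A - B) / 2 + (A - B) * (A ^ 2 + A * B + B ^ 2) / 300 := by
          simp only [angleGauge, hpA, hqB]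
          ring
        rw [this]
        have : 0 ≤ A - B := by linarith
        have : 0 ≤ A := by linarith
        positivity
    rw [hg]
    obtain ⟨t1, -⟩ := tan_sub_self_le (t := (A - B) / 4) (by linarith) (by linarith)
    set x := (A - B) / 2 with hx
    set n := (A + B) / 2 with hn
    have hx0 : 0 ≤ x := by linarith
    have hxn : x ≤ n := by linarith
    have hn2 : n ≤ π / 2 := by linarith
    have hsn : sin x ≤ sin n := sin_le_sin_of_le_of_le_pi_div_two (by linarith [pi_pos]) hn2 hxn
    have hsx : 0 ≤ sin x := sin_nonneg_of_nonneg_of_le_pi hx0 (by linarith [pi_pos])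
    have hcx : 0 ≤ cos x := cos_nonneg_of_neg_pi_div_two_le_of_le (by linarith [pi_pos])
      (by linarith)
    have hcx2 : 1 / 2 ≤ cos x := by
      rw [← cos_pi_div_three]
      exact cos_le_cos_of_nonneg_of_le_pi hx0 (by linarith [pi_pos]) (by linarith [pi_pos])
    have hjordan : 2 / π * n ≤ sin n := mul_le_sin (by linarith) hn2
    have hnA : A / 2 ≤ n := by linarith
    have hsA : A / 4 ≤ sin n := by
      have h1 : 1 / 2 ≤ 2 / π := by
        rw [div_le_div_iff₀ (by norm_num) pi_pos]; linarith [pi_lt_four]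
      nlinarith
    have hmain : 1 + A ^ 2 / 50 ≤ cos x + sin n ^ 2 := by
      have h1 := sin_sq_add_cos_sq x
      -- From `1 - cos x = sin x ^ 2 / (1 + cos x)` and `cos x ≥ 1/2`. A third of `sin n ^ 2 ≥ A ^ 2
      -- / 16` survives, giving `A ^ 2 / 48`.
      have h2 : 1 - cos x ≤ 2 / 3 * sin x ^ 2 := by nlinarith [cos_le_one x]
      have h3 : sin x ^ 2 ≤ sin n ^ 2 := by gcongr
      have h4 : A ^ 2 / 16 ≤ sin n ^ 2 := by
        have : (A / 4) ^ 2 ≤ sin n ^ 2 := by gcongr; linarith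
        linarith
      nlinarith
    have h5 : A ^ 2 + A * B + B ^ 2 ≤ 3 * A ^ 2 := by nlinarith
    have h6 : 2 * tan ((A - B) / 4) ≥ (A - B) / 2 := by linarith
    calc x + (A - B) * (A ^ 2 + A * B + B ^ 2) / 300
        ≤ x + (A - B) * (3 * A ^ 2) / 300 := by
          have : 0 ≤ A - B := by linarith
          gcongr
      _ = (A - B) / 2 * (1 + A ^ 2 / 50) := by rw [hx]; ring
      _ ≤ 2 * tan ((A - B) / 4) * (cos x + sin n ^ 2) := by
          apply mul_le_mul h6 hmain (by positivity) (by linarith)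
  rcases le_total (p : ℝ) q with h | h
  · exact key p q h
  · rw [abs_sub_comm, rhombusKernel_comm]
    exact key q p h

/-! ### Integration against the state of a density -/

namespace Density

variable {M : Type*} [MeasurableSpace M] {μ : Measure M}

lemma integrable (f : Density μ) : Integrable f.toFun μ :=
  Integrable.of_integral_ne_zero (by rw [f.integral_eq_one']; exact one_ne_zero)

/-- The state of a density, as a measure. -/
noncomputable abbrev state (f : Density μ) : Measure M := (f.toProbabilityMeasure : Measure M)

lemma state_eq (f : Density μ) :
    f.state = μ.withDensity fun p => ENNReal.ofReal (f.toFun p) := rfl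

lemma measurable_ofReal (f : Density μ) : Measurable fun p => ENNReal.ofReal (f.toFun p) :=
  f.measurable'.ennreal_ofReal

lemma integral_state (f : Density μ) (h : M → ℝ) :
    ∫ p, h p ∂f.state = ∫ p, h p * f.toFun p ∂μ := by
  rw [state_eq, integral_withDensity_eq_integral_toReal_smul f.measurable_ofReal
    (ae_of_all _ fun _ => ENNReal.ofReal_lt_top)]
  refine integral_congr_ae (ae_of_all _ fun p => ?_)
  simp [ENNReal.toReal_ofReal (f.nonneg' p), mul_comm]

lemma integrable_state_iff (f : Density μ) {h : M → ℝ} :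
    Integrable h f.state ↔ Integrable (fun p => h p * f.toFun p) μ := by
  rw [state_eq, integrable_withDensity_iff f.measurable_ofReal
    (ae_of_all _ fun _ => ENNReal.ofReal_lt_top)]
  simp_rw [ENNReal.toReal_ofReal (f.nonneg' _)]

lemma ae_of_ae_state (f : Density μ) {P : M → Prop} (h : ∀ᵐ p ∂f.state, P p) :
    ∀ᵐ p ∂μ, f.toFun p ≠ 0 → P p := by
  rw [state_eq, ae_withDensity_iff f.measurable_ofReal] at h
  filter_upwards [h] with p hp hne
  exact hp (by simpa using lt_of_le_of_ne (f.nonneg' p) hne.symm)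

lemma potential_eq (k : M → M → ℝ) (f : Density μ) (p : M) :
    potential k f p = ∫ q, k p q ∂f.state := (f.integral_state _).symm

end Density

/-! ### Logarithmic moments of sub-uniform functions -/

section LogMoment

variable {X : Type*} [MeasurableSpace X] {ν : Measure X} {G : X → ℝ}

/-- By inner regularity it suffices to bound compact subsets of the sublevel set. For distribution
functions the point supplied by `h` is the maximum or minimum of `K`, so atoms need no separate
treatment. -/
lemma measure_sublevel_le [TopologicalSpace X] [IsProbabilityMeasure ν]
    [ν.InnerRegularCompactLTTop] (hG : Measurable G)
    (h : ∀ K : Set X, IsCompact K → K.Nonempty → ∃ x ∈ K, ν.real K ≤ G x) (t : ℝ) :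
    ν {x | G x ≤ t} ≤ ENNReal.ofReal t := by
  rw [(measurableSet_le hG measurable_const).measure_eq_iSup_isCompact_of_ne_top
    (measure_ne_top ν _)]
  refine iSup₂_le fun K hK => iSup_le fun hc => ?_
  rcases K.eq_empty_or_nonempty with rfl | hne
  · simp
  · obtain ⟨x, hx, hle⟩ := h K hc hne
    rw [← ofReal_measureReal (measure_ne_top ν K)]
    exact ENNReal.ofReal_le_ofReal (hle.trans (hK hx))

lemma ae_pos_of_measure_sublevel_le (hν : ∀ t, ν {x | G x ≤ t} ≤ ENNReal.ofReal t) :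
    ∀ᵐ x ∂ν, 0 < G x := by
  rw [ae_iff]
  simpa using hν 0

/-- Layer-cake: the tails of `-log G` are bounded by those of a standard exponential variable, whose
mean is 1. -/
lemma lintegral_neg_log_le (hG : Measurable G) (h0 : ∀ x, 0 ≤ G x) (h1 : ∀ x, G x ≤ 1)
    (hν : ∀ t, ν {x | G x ≤ t} ≤ ENNReal.ofReal t) :
    ∫⁻ x, ENNReal.ofReal (-log (G x)) ∂ν ≤ 1 := by
  rw [lintegral_eq_lintegral_meas_le ν
    (ae_of_all _ fun x => neg_nonneg.2 (log_nonpos (h0 x) (h1 x))) (by fun_prop)]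
  calc ∫⁻ t in Set.Ioi (0 : ℝ), ν {x | t ≤ -log (G x)}
      ≤ ∫⁻ t in Set.Ioi (0 : ℝ), ENNReal.ofReal (exp (-t)) := by
        refine lintegral_mono fun t => (measure_mono fun x hx => ?_).trans (hν _)
        have hx' : t ≤ -log (G x) := hx
        change G x ≤ exp (-t)
        -- At a zero of `G` the convention `log 0 = 0` applies, but there `G x ≤ exp (-t)` is
        -- trivial.
        rcases (h0 x).eq_or_lt with h | h
        · rw [← h]; positivity
        · rw [← log_le_iff_le_exp h]; linarith
    _ = 1 := by
        rw [← ofReal_integral_eq_lintegral_ofReal (integrableOn_exp_neg_Ioi 0)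
          (ae_of_all _ fun t => (exp_pos _).le), integral_exp_neg_Ioi_zero, ENNReal.ofReal_one]

lemma integrable_log_of_measure_sublevel_le (hG : Measurable G) (h0 : ∀ x, 0 ≤ G x)
    (h1 : ∀ x, G x ≤ 1) (hν : ∀ t, ν {x | G x ≤ t} ≤ ENNReal.ofReal t) :
    Integrable (fun x => log (G x)) ν := by
  have hneg : Integrable (fun x => -log (G x)) ν := by
    refine ⟨hG.log.neg.aestronglyMeasurable, ?_⟩
    rw [hasFiniteIntegral_iff_ofReal (ae_of_all _ fun x => neg_nonneg.2 (log_nonpos (h0 x) (h1 x)))]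
    exact (lintegral_neg_log_le hG h0 h1 hν).trans_lt ENNReal.one_lt_top
  simpa using hneg.neg

lemma neg_one_le_integral_log (hG : Measurable G) (h0 : ∀ x, 0 ≤ G x) (h1 : ∀ x, G x ≤ 1)
    (hν : ∀ t, ν {x | G x ≤ t} ≤ ENNReal.ofReal t) :
    -1 ≤ ∫ x, log (G x) ∂ν := by
  have h : ∫ x, -log (G x) ∂ν ≤ 1 := by
    rw [integral_eq_lintegral_of_nonneg_ae
      (ae_of_all _ fun x => neg_nonneg.2 (log_nonpos (h0 x) (h1 x)))
      hG.log.neg.aestronglyMeasurable]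
    exact ENNReal.toReal_le_of_le_ofReal zero_le_one
      (by simpa using lintegral_neg_log_le hG h0 h1 hν)
  rw [integral_neg] at h
  linarith

end LogMoment

/-! ### Distribution functions and the mean difference -/

section Uniform

lemma integral_uniformAngle (H : ℝ → ℝ) :
    ∫ p : RhombusAngle, H p ∂uniformAngle = 2 / π * ∫ s in (0 : ℝ)..π / 2, H s := by
  have hpi := pi_pos
  rw [uniformAngle, integral_smul_measure, ENNReal.toReal_ofReal (by positivity),
    integral_subtype_comap measurableSet_Icc, integral_Icc_eq_integral_Ioc,
    intervalIntegral.integral_of_le (by positivity), smul_eq_mul]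

instance isProbabilityMeasure_uniformAngle : IsProbabilityMeasure uniformAngle := by
  constructor
  have hpi := pi_pos
  rw [uniformAngle, Measure.smul_apply,
    (MeasurableEmbedding.subtype_coe measurableSet_Icc).comap_apply, Set.image_univ,
    Subtype.range_coe, Real.volume_Icc, smul_eq_mul, sub_zero,
    ← ENNReal.ofReal_mul (by positivity)]
  simp [div_mul_div_cancel₀', hpi.ne', div_self]

variable (ν : Measure RhombusAngle) [IsProbabilityMeasure ν]

lemma measurable_measureReal_Iic : Measurable fun s : RhombusAngle => ν.real (Set.Iic s) :=
  Monotone.measurable fun _ _ h => measureReal_mono (Set.Iic_subset_Iic.2 h)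

lemma measurable_measureReal_Ici : Measurable fun s : RhombusAngle => ν.real (Set.Ici s) :=
  Antitone.measurable fun _ _ h => measureReal_mono (Set.Ici_subset_Ici.2 h)

lemma measure_measureReal_Iic_le (t : ℝ) : ν {s | ν.real (Set.Iic s) ≤ t} ≤ ENNReal.ofReal t :=
  measure_sublevel_le (measurable_measureReal_Iic ν) (fun K hc hne => by
    obtain ⟨a, ha, hmax⟩ := hc.exists_isGreatest hne
    exact ⟨a, ha, measureReal_mono fun x hx => hmax hx⟩) t

lemma measure_measureReal_Ici_le (t : ℝ) : ν {s | ν.real (Set.Ici s) ≤ t} ≤ ENNReal.ofReal t :=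
  measure_sublevel_le (measurable_measureReal_Ici ν) (fun K hc hne => by
    obtain ⟨a, ha, hmin⟩ := hc.exists_isLeast hne
    exact ⟨a, ha, measureReal_mono fun x hx => hmin hx⟩) t

lemma integral_indicator_Icc_uniformAngle {Φ φ : ℝ → ℝ} (hφ : Continuous φ)
    (hΦ : ∀ s, HasDerivAt Φ (φ s) s) (hpos : ∀ s, 0 ≤ φ s) (p q : RhombusAngle) :
    ∫ s : RhombusAngle, φ s * ((Set.Iic s).indicator 1 p * (Set.Ici s).indicator 1 q)
      ∂uniformAngle =
      2 / π * max (Φ q - Φ p) 0 := by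
  have hmono : Monotone Φ := monotone_of_hasDerivAt_nonneg hΦ hpos
  have e : ∀ s : RhombusAngle, φ s * ((Set.Iic s).indicator 1 p * (Set.Ici s).indicator 1 q) =
      (Set.Icc (p : ℝ) q).indicator φ s := by
    intro s
    by_cases h1 : p ≤ s <;> by_cases h2 : s ≤ q <;>
      simp [h1, h2]
  simp_rw [e]
  rw [integral_uniformAngle (fun s => (Set.Icc (p : ℝ) q).indicator φ s),
    intervalIntegral.integral_of_le (by positivity), ← integral_Icc_eq_integral_Ioc,
    setIntegral_indicator measurableSet_Icc,
    Set.inter_eq_self_of_subset_right (Set.Icc_subset_Icc p.2.1 q.2.2)]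
  congr 1
  rcases le_total (p : ℝ) q with h | h
  · rw [integral_Icc_eq_integral_Ioc, ← intervalIntegral.integral_of_le h,
      intervalIntegral.integral_eq_sub_of_hasDerivAt (fun s _ => hΦ s)
        (hφ.intervalIntegrable _ _), max_eq_left (sub_nonneg.2 (hmono h))]
  · rw [integral_Icc_eq_integral_Ioc, Set.Ioc_eq_empty (not_lt.2 h), setIntegral_empty,
      max_eq_right (sub_nonpos.2 (hmono h))]

/-- The mean difference of `Φ` under a state, in terms of its distribution functions. -/
lemma integral_abs_sub_prod {Φ φ : ℝ → ℝ} (hφ : Continuous φ)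
    (hΦ : ∀ s, HasDerivAt Φ (φ s) s) (hpos : ∀ s, 0 ≤ φ s) :
    ∫ z : RhombusAngle × RhombusAngle, |Φ z.1 - Φ z.2| ∂(ν.prod ν) =
      π * ∫ s : RhombusAngle, φ s * (ν.real (Set.Iic s) * ν.real (Set.Ici s)) ∂uniformAngle := by
  have hpi := pi_pos
  set T : RhombusAngle × RhombusAngle → ℝ := fun z => max (Φ z.2 - Φ z.1) 0 with hT
  have hΦc : Continuous Φ := continuous_iff_continuousAt.2 fun s => (hΦ s).continuousAt
  have hTc : Continuous T := by simp only [hT]; fun_prop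
  have hTi : Integrable T (ν.prod ν) :=
    hTc.integrable_of_hasCompactSupport (HasCompactSupport.of_compactSpace _)
  have hTs : Integrable (fun z => T z.swap) (ν.prod ν) :=
    (hTc.comp continuous_swap).integrable_of_hasCompactSupport
      (HasCompactSupport.of_compactSpace _)
  have habs : ∀ z : RhombusAngle × RhombusAngle, |Φ z.1 - Φ z.2| = T z + T z.swap := by
    intro z
    simp only [hT, Prod.fst_swap, Prod.snd_swap]
    rcases le_total (Φ z.1) (Φ z.2) with h | h
    · rw [abs_of_nonpos (by linarith), max_eq_left (by linarith), max_eq_right (by linarith)]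
      ring
    · rw [abs_of_nonneg (by linarith), max_eq_right (by linarith), max_eq_left (by linarith)]
      ring
  have hswap : ∫ z, T z.swap ∂(ν.prod ν) = ∫ z, T z ∂(ν.prod ν) := integral_prod_swap _
  simp_rw [habs]
  rw [integral_add hTi hTs, hswap]
  obtain ⟨C, hC⟩ : ∃ C, ∀ s : RhombusAngle, φ s ≤ C := by
    obtain ⟨C, hC⟩ := (isCompact_range (hφ.comp continuous_subtype_val :
      Continuous fun s : RhombusAngle => φ s)).bddAbove
    exact ⟨C, fun s => hC ⟨s, rfl⟩⟩
  -- The positive part of `Φ q - Φ p` is the integral of `φ` over `p ≤ s ≤ q`. By Fubini and the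
  -- product structure, the inner integral in `z` splits into the two distribution functions.
  set H : (RhombusAngle × RhombusAngle) → RhombusAngle → ℝ := fun z s =>
    φ s * ((Set.Iic s).indicator 1 z.1 * (Set.Ici s).indicator 1 z.2) with hH
  have hHm : Measurable (Function.uncurry H) := by
    have m1 : Measurable fun w : (RhombusAngle × RhombusAngle) × RhombusAngle =>
        (Set.Iic w.2).indicator (1 : RhombusAngle → ℝ) w.1.1 :=
      (measurable_const (a := (1 : ℝ))).indicator
        (measurableSet_le (measurable_fst.comp measurable_fst) measurable_snd)
    have m2 : Measurable fun w : (RhombusAngle × RhombusAngle) × RhombusAngle =>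
        (Set.Ici w.2).indicator (1 : RhombusAngle → ℝ) w.1.2 :=
      (measurable_const (a := (1 : ℝ))).indicator
        (measurableSet_le measurable_snd (measurable_snd.comp measurable_fst))
    exact (hφ.measurable.comp (measurable_subtype_coe.comp measurable_snd)).mul (m1.mul m2)
  have hHi : Integrable (Function.uncurry H) ((ν.prod ν).prod uniformAngle) := by
    refine Integrable.of_bound hHm.aestronglyMeasurable C (ae_of_all _ fun w => ?_)
    have h0 := hpos w.2
    have h1 := hC w.2
    simp only [Function.uncurry, hH, Set.indicator_apply, Pi.one_apply]
    split_ifs <;> simp [abs_of_nonneg h0] <;> linarith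
  have h1 : ∫ z, T z ∂(ν.prod ν) = π / 2 * ∫ z, ∫ s, H z s ∂uniformAngle ∂(ν.prod ν) := by
    rw [← integral_const_mul]
    refine integral_congr_ae (ae_of_all _ fun z => ?_)
    simp only [hH, hT]
    rw [integral_indicator_Icc_uniformAngle hφ hΦ hpos]
    field_simp
  have h2 : ∀ s, ∫ z, H z s ∂(ν.prod ν) = φ s * (ν.real (Set.Iic s) * ν.real (Set.Ici s)) := by
    intro s
    simp only [hH]
    rw [integral_const_mul,
      integral_prod_mul (fun p => (Set.Iic s).indicator (1 : RhombusAngle → ℝ) p)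
        (fun p => (Set.Ici s).indicator (1 : RhombusAngle → ℝ) p),
      integral_indicator_one measurableSet_Iic,
      integral_indicator_one measurableSet_Ici]
  rw [h1, integral_integral_swap hHi]
  simp_rw [h2]
  ring

end Uniform

/-! ### Lower bound for the free energy -/

section Energy

variable (f : Density uniformAngle)

lemma integrable_rhombusKernel_prod (ν : Measure RhombusAngle) [IsProbabilityMeasure ν] :
    Integrable (fun z : RhombusAngle × RhombusAngle => rhombusKernel z.1 z.2) (ν.prod ν) :=
  continuous_rhombusKernel.integrable_of_hasCompactSupport (HasCompactSupport.of_compactSpace _)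

lemma integrable_potential_rhombusKernel : Integrable (potential rhombusKernel f) f.state := by
  have := (integrable_rhombusKernel_prod f.state).integral_prod_left
  exact this.congr (ae_of_all _ fun p => (Density.potential_eq _ f p).symm)

lemma integral_potential_rhombusKernel :
    ∫ p, potential rhombusKernel f p ∂f.state =
      ∫ z, rhombusKernel z.1 z.2 ∂(f.state.prod f.state) := by
  rw [integral_prod _ (integrable_rhombusKernel_prod f.state)]
  exact integral_congr_ae (ae_of_all _ fun p => Density.potential_eq _ f p)

/-- The kernel is continuous on a compact space, so the interaction term is always integrable and
only the entropy can be infinite. -/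
lemma integrable_freeEnergyIntegrand_iff (b : ℝ) :
    Integrable (freeEnergyIntegrand rhombusKernel b f) uniformAngle ↔
      Integrable (fun p => log (f.toFun p) * f.toFun p) uniformAngle := by
  have hU : Integrable (fun p => b / 2 * (potential rhombusKernel f p * f.toFun p)) uniformAngle :=
    (f.integrable_state_iff.1 (integrable_potential_rhombusKernel f)).const_mul _
  have e : freeEnergyIntegrand rhombusKernel b f = fun p =>
      log (f.toFun p) * f.toFun p + b / 2 * (potential rhombusKernel f p * f.toFun p) := by
    ext p; simp only [freeEnergyIntegrand]; ring
  rw [e]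
  constructor
  · intro h
    exact (h.sub hU).congr (ae_of_all _ fun p => add_sub_cancel_right _ _)
  · intro h
    exact h.add hU

lemma integral_freeEnergyIntegrand {b : ℝ}
    (h : Integrable (fun p => log (f.toFun p) * f.toFun p) uniformAngle) :
    ∫ p, freeEnergyIntegrand rhombusKernel b f p ∂uniformAngle =
      ∫ p, log (f.toFun p) * f.toFun p ∂uniformAngle +
        b / 2 * ∫ z, rhombusKernel z.1 z.2 ∂(f.state.prod f.state) := by
  have hU : Integrable (fun p => b / 2 * (potential rhombusKernel f p * f.toFun p)) uniformAngle :=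
    (f.integrable_state_iff.1 (integrable_potential_rhombusKernel f)).const_mul _
  rw [← integral_potential_rhombusKernel, f.integral_state, ← integral_const_mul,
    ← integral_add h hU]
  refine integral_congr_ae (ae_of_all _ fun p => ?_)
  simp only [freeEnergyIntegrand]
  ring

/-- The left side is the tangent line at `y` of the convex function `x log x`. -/
lemma mul_log_add_one_sub_le {x y : ℝ} (hx : 0 ≤ x) (hy : 0 < y) :
    x * (log y + 1) - y ≤ log x * x := by
  rcases hx.eq_or_lt with rfl | hx
  · simpa using hy.le
  · have h := log_le_sub_one_of_pos (div_pos hy hx)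
    rw [log_div hy.ne' hx.ne'] at h
    have h2 := mul_le_mul_of_nonneg_left h hx.le
    have e : x * (y / x - 1) = y - x := by field_simp
    rw [e] at h2
    nlinarith

lemma integrable_log_angleGaugeDeriv (ν : Measure RhombusAngle) [IsProbabilityMeasure ν] :
    Integrable (fun p : RhombusAngle => log (angleGaugeDeriv p)) ν := by
  have hc : Continuous fun p : RhombusAngle => log (angleGaugeDeriv p) :=
    (continuous_angleGaugeDeriv.comp continuous_subtype_val).log
      fun p => (angleGaugeDeriv_pos p).ne'
  exact hc.integrable_of_hasCompactSupport (HasCompactSupport.of_compactSpace _)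

/-- The sharp lower bound of the free energy. -/
lemma le_integral_freeEnergyIntegrand {b : ℝ} (hb : 0 < b)
    (hint : Integrable (fun p => log (f.toFun p) * f.toFun p) uniformAngle) :
    log b + log (π / 2) - 1 + ∫ p : RhombusAngle, log (angleGaugeDeriv p) ∂f.state ≤
      ∫ p, freeEnergyIntegrand rhombusKernel b f p ∂uniformAngle := by
  have hpi := pi_pos
  rw [integral_freeEnergyIntegrand f hint]
  set ν := f.state with hν
  set F : RhombusAngle → ℝ := fun s => ν.real (Set.Iic s) with hF
  set G : RhombusAngle → ℝ := fun s => ν.real (Set.Ici s) with hG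
  have hFm : Measurable F := measurable_measureReal_Iic ν
  have hGm : Measurable G := measurable_measureReal_Ici ν
  have hF0 : ∀ s, 0 ≤ F s := fun s => measureReal_nonneg
  have hG0 : ∀ s, 0 ≤ G s := fun s => measureReal_nonneg
  have hF1 : ∀ s, F s ≤ 1 := fun s => measureReal_le_one
  have hG1 : ∀ s, G s ≤ 1 := fun s => measureReal_le_one
  have hFν := measure_measureReal_Iic_le ν
  have hGν := measure_measureReal_Ici_le ν
  have hFi := integrable_log_of_measure_sublevel_le hFm hF0 hF1 hFν
  have hGi := integrable_log_of_measure_sublevel_le hGm hG0 hG1 hGν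
  have hφi := integrable_log_angleGaugeDeriv ν
  have hk : π * ∫ s : RhombusAngle, angleGaugeDeriv s * (F s * G s) ∂uniformAngle ≤
      ∫ z, rhombusKernel z.1 z.2 ∂(ν.prod ν) := by
    rw [← integral_abs_sub_prod ν continuous_angleGaugeDeriv hasDerivAt_angleGauge
      fun s => (angleGaugeDeriv_pos s).le]
    refine integral_mono ?_ (integrable_rhombusKernel_prod ν)
      fun z => abs_angleGauge_sub_le_rhombusKernel z.1 z.2
    have hc : Continuous angleGauge :=
      continuous_iff_continuousAt.2 fun s => (hasDerivAt_angleGauge s).continuousAt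
    have : Continuous fun z : RhombusAngle × RhombusAngle =>
        |angleGauge z.1 - angleGauge z.2| := by fun_prop
    exact this.integrable_of_hasCompactSupport (HasCompactSupport.of_compactSpace _)
  -- Chosen so that `∫ y dμ` is exactly the lower bound for the interaction energy, which then
  -- cancels.
  set y : RhombusAngle → ℝ := fun s => b * (π / 2) * (angleGaugeDeriv s * (F s * G s)) with hy
  set L : RhombusAngle → ℝ := fun s =>
    (log b + log (π / 2) + 1) + log (angleGaugeDeriv s) + (log (F s) + log (G s)) with hL
  have hyi : Integrable y uniformAngle := by
    have h1 : Integrable (fun s : RhombusAngle => angleGaugeDeriv s) uniformAngle :=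
      (continuous_angleGaugeDeriv.comp continuous_subtype_val).integrable_of_hasCompactSupport
        (HasCompactSupport.of_compactSpace _)
    refine (h1.mul_bdd (c := 1) (hFm.mul hGm).aestronglyMeasurable
      (ae_of_all _ fun s => ?_)).const_mul _
    rw [Pi.mul_apply, norm_eq_abs, abs_of_nonneg (mul_nonneg (hF0 s) (hG0 s))]
    exact mul_le_one₀ (hF1 s) (hG0 s) (hG1 s)
  have hLi : Integrable L ν :=
    ((integrable_const _).add hφi).add (hFi.add hGi)
  have hLint : ∫ s, L s ∂ν = (log b + log (π / 2) + 1) +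
      ∫ s : RhombusAngle, log (angleGaugeDeriv s) ∂ν +
      (∫ s, log (F s) ∂ν + ∫ s, log (G s) ∂ν) := by
    have e1 := integral_add ((integrable_const (log b + log (π / 2) + 1)).add hφi) (hFi.add hGi)
    have e2 := integral_add (integrable_const (μ := ν) (log b + log (π / 2) + 1)) hφi
    have e3 := integral_add hFi hGi
    simp only [Pi.add_apply, integral_const, probReal_univ, one_smul] at e1 e2 e3
    rw [e2, e3] at e1
    exact e1
  have hpt : ∀ᵐ s ∂uniformAngle, L s * f.toFun s - y s ≤ log (f.toFun s) * f.toFun s := by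
    filter_upwards [f.ae_of_ae_state (ae_pos_of_measure_sublevel_le hFν),
      f.ae_of_ae_state (ae_pos_of_measure_sublevel_le hGν)] with s h1 h2
    have hφ := angleGaugeDeriv_pos s
    -- `F` and `G` are positive only almost everywhere for the state, hence only where the density
    -- is nonzero; elsewhere `y ≥ 0` suffices.
    rcases eq_or_ne (f.toFun s) 0 with h | h
    · have : 0 ≤ y s := by
        have := hF0 s
        have := hG0 s
        simp only [hy]
        positivity
      simpa [h] using this
    · have hFs : 0 < F s := h1 h
      have hGs : 0 < G s := h2 h
      have hys : 0 < y s := by simp only [hy]; positivity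
      have := mul_log_add_one_sub_le (f.nonneg' s) hys
      have hlog : log (y s) + 1 = L s := by
        simp only [hy, hL]
        rw [log_mul (by positivity) (by positivity), log_mul (by positivity) (by positivity),
          log_mul (by positivity) (by positivity), log_mul (by positivity) (by positivity)]
        ring
      rw [hlog] at this
      linarith
  have hLf := f.integrable_state_iff.1 hLi
  have hmono := integral_mono_ae (hLf.sub hyi) hint hpt
  simp only [Pi.sub_apply] at hmono
  rw [integral_sub hLf hyi, ← f.integral_state, ← hν, hLint, integral_const_mul] at hmono
  have h1 := neg_one_le_integral_log hFm hF0 hF1 hFν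
  have h2 := neg_one_le_integral_log hGm hG0 hG1 hGν
  have h3 := mul_le_mul_of_nonneg_left hk (by positivity : 0 ≤ b / 2)
  linarith

end Energy

/-! ### Trial densities: truncated logistic profiles at the square -/

section Trial

/-- A rescaled logistic function, which reaches the values `0` and `1` in finite time. -/
lemma exists_logistic {δ : ℝ} (hδ : 0 < δ) :
    ∃ L > 0, ∃ G : ℝ → ℝ, (∀ x, HasDerivAt G ((G x + δ) * (1 + δ - G x)) x) ∧
      (∀ x, 0 < G x + δ) ∧ (∀ x, 0 < 1 + δ - G x) ∧ G (-L) = 0 ∧ G 0 = 1 := by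
  set K : ℝ := 1 + 2 * δ with hK
  have hK0 : 0 < K := by positivity
  have hC : 1 < (1 + δ) / δ := by rw [one_lt_div hδ]; linarith
  -- The time in which the centred logistic function `K / (1 + exp (-K x))` climbs from its midpoint
  -- to `1 + δ`; by symmetry it equals `δ` at `-l`. Subtracting `δ` gives the values 0 and 1.
  set l : ℝ := log ((1 + δ) / δ) / K with hl
  have hl0 : 0 < l := div_pos (log_pos hC) hK0
  have hKl : K * l = log ((1 + δ) / δ) := by rw [hl]; field_simp
  refine ⟨2 * l, by positivity, fun x => K / (1 + exp (-(K * (x + l)))) - δ, ?_, ?_, ?_, ?_, ?_⟩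
  · intro x
    have hE : 0 < 1 + exp (-(K * (x + l))) := by positivity
    have h1 : HasDerivAt (fun x : ℝ => 1 + exp (-(K * (x + l))))
        (exp (-(K * (x + l))) * (-(K * 1))) x :=
      ((((hasDerivAt_id x).add_const l).const_mul K).neg.exp).const_add 1
    refine (((hasDerivAt_const x K).div h1 hE.ne').sub_const δ).congr_deriv ?_
    rw [hK]
    field_simp
    ring
  · intro x
    have : 0 < K / (1 + exp (-(K * (x + l)))) := by positivity
    simpa using this
  · intro x
    have hE : 1 < 1 + exp (-(K * (x + l))) := by linarith [exp_pos (-(K * (x + l)))]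
    have : K / (1 + exp (-(K * (x + l)))) < K := div_lt_self hK0 hE
    linarith
  · have : -(K * (-(2 * l) + l)) = log ((1 + δ) / δ) := by rw [← hKl]; ring
    simp only [this]
    rw [exp_log (by positivity), hK]
    field_simp
    ring
  · have : -(K * (0 + l)) = -log ((1 + δ) / δ) := by rw [← hKl]; ring
    simp only [this]
    rw [exp_neg, exp_log (by positivity), hK]
    field_simp
    ring

lemma integral_indicator_Icc (H : ℝ → ℝ) {u v : ℝ} (hu : 0 ≤ u) (huv : u ≤ v) (hv : v ≤ π / 2) :
    ∫ p : RhombusAngle, (Set.Icc u v).indicator H p ∂uniformAngle =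
      2 / π * ∫ s in u..v, H s := by
  rw [integral_uniformAngle (fun s => (Set.Icc u v).indicator H s),
    intervalIntegral.integral_of_le (by positivity), ← integral_Icc_eq_integral_Ioc,
    setIntegral_indicator measurableSet_Icc,
    Set.inter_eq_self_of_subset_right (Set.Icc_subset_Icc hu hv), integral_Icc_eq_integral_Ioc,
    ← intervalIntegral.integral_of_le huv]

/-- The density of a probability measure on `[a, π / 2]` with distribution function `F`. -/
noncomputable def cdfDensity {F F' : ℝ → ℝ} (hF : ∀ x, HasDerivAt F (F' x) x)
    (hF' : Continuous F') (hpos : ∀ x, 0 ≤ F' x) {a : ℝ} (ha : 0 ≤ a) (ha' : a ≤ π / 2)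
    (hFa : F a = 0) (hF1 : F (π / 2) = 1) : Density uniformAngle where
  toFun p := (Set.Icc a (π / 2)).indicator (fun s => π / 2 * F' s) p
  measurable' := ((hF'.measurable.const_mul _).indicator measurableSet_Icc).comp
    measurable_subtype_coe
  nonneg' p := Set.indicator_nonneg (fun s _ => mul_nonneg (by positivity) (hpos s)) _
  integral_eq_one' := by
    have hpi := pi_pos
    rw [integral_indicator_Icc _ ha ha' le_rfl, intervalIntegral.integral_const_mul,
      intervalIntegral.integral_eq_sub_of_hasDerivAt (fun s _ => hF s)
        (hF'.intervalIntegrable _ _), hFa, hF1]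
    field_simp
    norm_num

variable {F F' : ℝ → ℝ} (hF : ∀ x, HasDerivAt F (F' x) x)
    (hF' : Continuous F') (hpos : ∀ x, 0 ≤ F' x) {a : ℝ} (ha : 0 ≤ a) (ha' : a ≤ π / 2)
    (hFa : F a = 0) (hF1 : F (π / 2) = 1)

lemma cdfDensity_apply (p : RhombusAngle) :
    (cdfDensity hF hF' hpos ha ha' hFa hF1).toFun p =
      (Set.Icc a (π / 2)).indicator (fun s => π / 2 * F' s) p := rfl

lemma cdfDensity_real_Icc {u v : RhombusAngle} (hau : a ≤ u) (huv : u ≤ v) :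
    ((cdfDensity hF hF' hpos ha ha' hFa hF1).state).real (Set.Icc u v) = F v - F u := by
  have hpi := pi_pos
  rw [← integral_indicator_one measurableSet_Icc, Density.integral_state]
  have e : ∀ p : RhombusAngle, (Set.Icc u v).indicator (1 : RhombusAngle → ℝ) p *
      (cdfDensity hF hF' hpos ha ha' hFa hF1).toFun p =
      (Set.Icc (u : ℝ) v).indicator (fun s => π / 2 * F' s) p := by
    intro p
    rw [cdfDensity_apply]
    by_cases h : p ∈ Set.Icc u v
    · have h1 : (p : ℝ) ∈ Set.Icc a (π / 2) := ⟨hau.trans h.1, p.2.2⟩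
      have h2 : (p : ℝ) ∈ Set.Icc (u : ℝ) v := h
      rw [Set.indicator_of_mem h, Set.indicator_of_mem h1, Set.indicator_of_mem h2]
      simp
    · have h2 : (p : ℝ) ∉ Set.Icc (u : ℝ) v := h
      rw [Set.indicator_of_notMem h, Set.indicator_of_notMem h2, zero_mul]
  simp_rw [e]
  rw [integral_indicator_Icc _ u.2.1 huv v.2.2, intervalIntegral.integral_const_mul,
    intervalIntegral.integral_eq_sub_of_hasDerivAt (fun s _ => hF s)
      (hF'.intervalIntegrable _ _)]
  field_simp

lemma cdfDensity_ae_le :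
    ∀ᵐ p : RhombusAngle ∂(cdfDensity hF hF' hpos ha ha' hFa hF1).state, a ≤ (p : ℝ) := by
  rw [Density.state_eq, ae_withDensity_iff (Density.measurable_ofReal _)]
  refine ae_of_all _ fun p hp => ?_
  by_contra h
  refine hp ?_
  rw [cdfDensity_apply, Set.indicator_of_notMem (fun hm => h hm.1), ENNReal.ofReal_zero]

lemma cdfDensity_real_Iic (u : RhombusAngle) (hau : a ≤ u) :
    ((cdfDensity hF hF' hpos ha ha' hFa hF1).state).real (Set.Iic u) = F u := by
  have h := cdfDensity_real_Icc hF hF' hpos ha ha' hFa hF1 (u := ⟨a, ha, ha'⟩) (v := u) le_rfl hau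
  rw [hFa, sub_zero] at h
  rw [← h]
  refine measureReal_congr ?_
  filter_upwards [cdfDensity_ae_le hF hF' hpos ha ha' hFa hF1] with p hp
  exact propext ⟨fun h => ⟨hp, h⟩, fun h => h.2⟩

lemma cdfDensity_real_Ici (u : RhombusAngle) (hau : a ≤ u) :
    ((cdfDensity hF hF' hpos ha ha' hFa hF1).state).real (Set.Ici u) = 1 - F u := by
  have h := cdfDensity_real_Icc hF hF' hpos ha ha' hFa hF1 (u := u) (v := squareAngle) hau u.2.2
  have e : Set.Icc u squareAngle = Set.Ici u := by
    ext p
    exact ⟨fun h => h.1, fun h => ⟨h, p.2.2⟩⟩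
  rw [← e, h]
  exact congrArg (· - F u) hF1

lemma cdfDensity_real_Iic_of_lt (u : RhombusAngle) (hua : (u : ℝ) < a) :
    ((cdfDensity hF hF' hpos ha ha' hFa hF1).state).real (Set.Iic u) = 0 := by
  rw [measureReal_eq_zero_iff, ← compl_mem_ae_iff]
  filter_upwards [cdfDensity_ae_le hF hF' hpos ha ha' hFa hF1] with p hp hpu
  exact absurd (hp.trans hpu) (not_le.2 hua)

lemma integral_abs_sub_cdfDensity :
    ∫ z : RhombusAngle × RhombusAngle, |(z.1 : ℝ) - z.2|
      ∂((cdfDensity hF hF' hpos ha ha' hFa hF1).state.prod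
        (cdfDensity hF hF' hpos ha ha' hFa hF1).state) =
      2 * ∫ s in a..π / 2, F s * (1 - F s) := by
  have hpi := pi_pos
  have h := integral_abs_sub_prod (cdfDensity hF hF' hpos ha ha' hFa hF1).state (Φ := id)
    (φ := fun _ => 1) continuous_const hasDerivAt_id (fun _ => zero_le_one)
  simp only [id] at h
  rw [h]
  have e : ∀ s : RhombusAngle,
      1 * (((cdfDensity hF hF' hpos ha ha' hFa hF1).state).real (Set.Iic s) *
        ((cdfDensity hF hF' hpos ha ha' hFa hF1).state).real (Set.Ici s)) =
      (Set.Icc a (π / 2)).indicator (fun s => F s * (1 - F s)) s := by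
    intro s
    rw [one_mul]
    rcases le_or_gt a (s : ℝ) with has | has
    · rw [cdfDensity_real_Iic hF hF' hpos ha ha' hFa hF1 s has,
        cdfDensity_real_Ici hF hF' hpos ha ha' hFa hF1 s has,
        Set.indicator_of_mem (s := Set.Icc a (π / 2)) ⟨has, s.2.2⟩]
    · rw [cdfDensity_real_Iic_of_lt hF hF' hpos ha ha' hFa hF1 s has, zero_mul,
        Set.indicator_of_notMem fun hm => not_le.2 has hm.1]
  simp_rw [e]
  rw [integral_indicator_Icc _ ha ha' le_rfl]
  field_simp

/-- The free energy of a density is at most its value for the kernel `c |p - q|`, if this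
dominates the kernel on the support. -/
lemma freeEnergy_cdfDensity_le {b c : ℝ} (hb : 0 < b) (hF'pos : ∀ x, 0 < F' x)
    (hc : ∀ p q : RhombusAngle, a ≤ p → a ≤ q → rhombusKernel p q ≤ c * |(p : ℝ) - q|) :
    freeEnergy rhombusKernel b (cdfDensity hF hF' hpos ha ha' hFa hF1) ≤
      (((∫ s in a..π / 2, F' s * log (π / 2 * F' s)) +
        b * c * (∫ s in a..π / 2, F s * (1 - F s)) : ℝ) : EReal) := by
  have hpi := pi_pos
  set f := cdfDensity hF hF' hpos ha ha' hFa hF1 with hf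
  have hlogc : Continuous fun s => log (π / 2 * F' s) * (π / 2 * F' s) := by
    have : Continuous fun s => log (π / 2 * F' s) :=
      (hF'.const_mul _).log fun s => (mul_pos (by positivity) (hF'pos s)).ne'
    fun_prop
  have e : ∀ p : RhombusAngle, log (f.toFun p) * f.toFun p =
      (Set.Icc a (π / 2)).indicator (fun s => log (π / 2 * F' s) * (π / 2 * F' s)) p := by
    intro p
    rw [hf, cdfDensity_apply]
    by_cases h : (p : ℝ) ∈ Set.Icc a (π / 2)
    · rw [Set.indicator_of_mem h, Set.indicator_of_mem h]
    · rw [Set.indicator_of_notMem h, Set.indicator_of_notMem h, mul_zero]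
  have hint : Integrable (fun p => log (f.toFun p) * f.toFun p) uniformAngle := by
    simp_rw [e]
    have hc1 : Integrable (fun p : RhombusAngle => log (π / 2 * F' p) * (π / 2 * F' p))
        uniformAngle :=
      (hlogc.comp continuous_subtype_val).integrable_of_hasCompactSupport
        (HasCompactSupport.of_compactSpace _)
    exact hc1.indicator (measurable_subtype_coe measurableSet_Icc)
  rw [freeEnergy, if_pos ((integrable_freeEnergyIntegrand_iff f b).2 hint), EReal.coe_le_coe_iff,
    integral_freeEnergyIntegrand f hint]
  have h1 : ∫ p, log (f.toFun p) * f.toFun p ∂uniformAngle =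
      ∫ s in a..π / 2, F' s * log (π / 2 * F' s) := by
    simp_rw [e]
    rw [integral_indicator_Icc _ ha ha' le_rfl, ← intervalIntegral.integral_const_mul]
    refine intervalIntegral.integral_congr fun s _ => ?_
    field_simp
  have h2 : ∫ z, rhombusKernel z.1 z.2 ∂(f.state.prod f.state) ≤
      c * (2 * ∫ s in a..π / 2, F s * (1 - F s)) := by
    rw [← integral_abs_sub_cdfDensity hF hF' hpos ha ha' hFa hF1, ← hf, ← integral_const_mul]
    have hcont : Continuous fun z : RhombusAngle × RhombusAngle => c * |(z.1 : ℝ) - z.2| := by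
      fun_prop
    refine integral_mono_ae (integrable_rhombusKernel_prod f.state)
      (hcont.integrable_of_hasCompactSupport (HasCompactSupport.of_compactSpace _)) ?_
    have hae := cdfDensity_ae_le hF hF' hpos ha ha' hFa hF1
    have hae1 : ∀ᵐ z : RhombusAngle × RhombusAngle ∂(f.state.prod f.state), a ≤ (z.1 : ℝ) :=
      Measure.quasiMeasurePreserving_fst.ae hae
    have hae2 : ∀ᵐ z : RhombusAngle × RhombusAngle ∂(f.state.prod f.state), a ≤ (z.2 : ℝ) :=
      Measure.quasiMeasurePreserving_snd.ae hae
    filter_upwards [hae1, hae2] with z hz1 hz2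
    exact hc z.1 z.2 hz1 hz2
  rw [h1]
  have h3 := mul_le_mul_of_nonneg_left h2 (by positivity : 0 ≤ b / 2)
  linarith

end Trial

/-- The diagonal slope `(1 + cos^2 p)/2` exceeds 1/2 by at most `(π/2 - a)/2`, and the quadratic
remainder adds `2 (π/2 - a)`. -/
lemma rhombusKernel_le_near_square {a : ℝ} (p q : RhombusAngle) (hp : a ≤ p) (hq : a ≤ q) :
    rhombusKernel p q ≤ (1 / 2 + 5 / 2 * (π / 2 - a)) * |(p : ℝ) - q| := by
  have key : ∀ p q : RhombusAngle, a ≤ p → (p : ℝ) ≤ q →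
      rhombusKernel p q ≤ (1 / 2 + 5 / 2 * (π / 2 - a)) * |(p : ℝ) - q| := by
    intro p q hp hpq
    have hq := q.2.2
    have h := (abs_le.1 (abs_rhombusKernel_sub_le (p := p) (q := q) (ε := (q : ℝ) - p)
      (by linarith) (by ring))).2
    rw [abs_sub_comm, abs_of_nonneg (sub_nonneg.2 hpq)]
    have hcos0 : 0 ≤ cos (p : ℝ) :=
      cos_nonneg_of_neg_pi_div_two_le_of_le (by linarith [pi_pos, p.2.1]) p.2.2
    have hcos1 : cos (p : ℝ) ≤ π / 2 - a := by
      rw [← sin_pi_div_two_sub]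
      exact (sin_le (by linarith)).trans (by linarith)
    have hsq : cos (p : ℝ) ^ 2 ≤ π / 2 - a := by nlinarith [cos_le_one (p : ℝ)]
    rw [sin_half_pow_four_add_cos_half_pow_four] at h
    have hε : 0 ≤ (q : ℝ) - p := by linarith
    have h4 : ((q : ℝ) - p) * ((1 + cos p ^ 2) / 2) ≤ ((q : ℝ) - p) * ((1 + (π / 2 - a)) / 2) := by
      gcongr
    have h5 : ((q : ℝ) - p) * ((q : ℝ) - p) ≤ ((q : ℝ) - p) * (π / 2 - a) := by
      gcongr
    nlinarith
  rcases le_total (p : ℝ) q with h | h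
  · exact key p q hp h
  · rw [rhombusKernel_comm, abs_sub_comm]
    exact key q p hq h

/-- Logistic profiles of width `L / lam` at the square have nearly minimal free energy. -/
lemma exists_freeEnergy_le {δ : ℝ} (hδ : 0 < δ) :
    ∃ L > 0, ∀ b > 0, 2 * L / b ≤ π / 2 → ∃ f : Density uniformAngle,
      freeEnergy rhombusKernel b f ≤
        ((log (π / 2) + log b - log 2 + 2 * ((1 + δ) * log (1 + δ) - δ * log δ) - 1 +
          10 * L / b : ℝ) : EReal) := by
  obtain ⟨L, hL, G, hG, hG0, hG1, hGL, hGz⟩ := exists_logistic hδ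
  refine ⟨L, hL, fun b hb hLb => ?_⟩
  have hpi := pi_pos
  -- The rate of the optimal logistic law for the limiting kernel `|p - q| / 2`.
  set lam := b / 2 with hlam
  have hlam0 : 0 < lam := by positivity
  set a := π / 2 - L / lam with ha
  have hLlam : L / lam = 2 * L / b := by rw [hlam]; field_simp
  have ha0 : 0 ≤ a := by rw [ha, hLlam]; linarith
  have ha1 : a ≤ π / 2 := by rw [ha]; linarith [div_pos hL hlam0]
  set F : ℝ → ℝ := fun x => G (lam * (x - π / 2)) with hFdef
  set F' : ℝ → ℝ := fun x => lam * ((F x + δ) * (1 + δ - F x)) with hF'def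
  have hGc : Continuous G := continuous_iff_continuousAt.2 fun x => (hG x).continuousAt
  have hFd : ∀ x, HasDerivAt F (F' x) x := by
    intro x
    have h1 : HasDerivAt (fun x : ℝ => lam * (x - π / 2)) (lam * 1) x :=
      ((hasDerivAt_id x).sub_const _).const_mul lam
    refine ((hG _).comp x h1).congr_deriv ?_
    simp only [hF'def, hFdef]
    ring
  have hFc : Continuous F := by simp only [hFdef]; fun_prop
  have hF'c : Continuous F' := by simp only [hF'def]; fun_prop
  have hFp0 : ∀ x, 0 < F x + δ := fun x => hG0 _
  have hFp1 : ∀ x, 0 < 1 + δ - F x := fun x => hG1 _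
  have hF'pos : ∀ x, 0 < F' x := fun x => mul_pos hlam0 (mul_pos (hFp0 x) (hFp1 x))
  have hFa : F a = 0 := by
    simp only [hFdef, ha]
    rw [show lam * (π / 2 - L / lam - π / 2) = -L by field_simp; ring]
    exact hGL
  have hF1 : F (π / 2) = 1 := by simp [hFdef, hGz]
  refine ⟨cdfDensity hFd hF'c (fun x => (hF'pos x).le) ha0 ha1 hFa hF1,
    (freeEnergy_cdfDensity_le hFd hF'c _ ha0 ha1 hFa hF1 hb hF'pos
      (fun p q => rhombusKernel_le_near_square p q)).trans (EReal.coe_le_coe_iff.2 ?_)⟩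
  have hent : ∫ s in a..π / 2, F' s * log (π / 2 * F' s) =
      log (π / 2) + log lam + (2 * ((1 + δ) * log (1 + δ) - δ * log δ) - 2) := by
    -- With `u = F x` as variable the integrand is a constant plus `log (u + δ) + log (1 + δ - u)`;
    -- the `-2` offsets the two units from differentiating `v log v`.
    have hP : ∀ x ∈ Set.uIcc a (π / 2), HasDerivAt (fun x => (log (π / 2) + log lam - 2) * F x +
        ((F x + δ) * log (F x + δ) - (1 + δ - F x) * log (1 + δ - F x)))
        (F' x * log (π / 2 * F' x)) x := by
      intro x _
      have d0 := (hFd x).const_mul (log (π / 2) + log lam - 2)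
      have d1 := (hasDerivAt_mul_log (hFp0 x).ne').comp x ((hFd x).add_const δ)
      have d2 := (hasDerivAt_mul_log (hFp1 x).ne').comp x ((hFd x).const_sub (1 + δ))
      refine (d0.add (d1.sub d2)).congr_deriv ?_
      have hlog : log (π / 2 * F' x) =
          log (π / 2) + (log lam + (log (F x + δ) + log (1 + δ - F x))) := by
        simp only [hF'def]
        have h1 := (hFp0 x).ne'
        have h2 := (hFp1 x).ne'
        rw [log_mul (by positivity) (by positivity), log_mul (by positivity) (by positivity),
          log_mul h1 h2]
      rw [hlog]
      ring
    have hcont : Continuous fun s => F' s * log (π / 2 * F' s) :=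
      hF'c.mul ((hF'c.const_mul _).log fun s => (mul_pos (by positivity) (hF'pos s)).ne')
    rw [intervalIntegral.integral_eq_sub_of_hasDerivAt hP (hcont.intervalIntegrable _ _), hFa, hF1,
      show 1 + δ - 1 = δ by ring, sub_zero, zero_add]
    ring
  -- `F (1 - F) ≤ (F + δ) (1 + δ - F) = F' / lam`, and `F` rises from 0 to 1.
  have hvar : ∫ s in a..π / 2, F s * (1 - F s) ≤ 1 / lam := by
    have h1 : ∫ s in a..π / 2, F' s / lam = 1 / lam := by
      rw [intervalIntegral.integral_div, intervalIntegral.integral_eq_sub_of_hasDerivAt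
        (fun s _ => hFd s) (hF'c.intervalIntegrable _ _), hFa, hF1, sub_zero]
    rw [← h1]
    refine intervalIntegral.integral_mono_on ha1 (Continuous.intervalIntegrable (by fun_prop) _ _)
      (Continuous.intervalIntegrable (by fun_prop) _ _) fun s _ => ?_
    simp only [hF'def]
    rw [mul_div_cancel_left₀ _ hlam0.ne']
    nlinarith [hFp0 s, hFp1 s]
  have hD : π / 2 - a = 2 * L / b := by rw [ha, hLlam]; ring
  rw [hent, hD]
  have hcoef : 0 ≤ b * (1 / 2 + 5 / 2 * (2 * L / b)) := by positivity
  have h := mul_le_mul_of_nonneg_left hvar hcoef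
  have hval : b * (1 / 2 + 5 / 2 * (2 * L / b)) * (1 / lam) = 1 + 10 * L / b := by
    rw [hlam]; field_simp; ring
  have hloglam : log lam = log b - log 2 := log_div hb.ne' two_ne_zero
  rw [hval] at h
  rw [hloglam]
  linarith

/-! ### Concentration of minimizers -/

/-- The excess of `angleGaugeDeriv` over its value at the square, on a logarithmic scale. -/
noncomputable def angleExcess (s : ℝ) : ℝ := log (angleGaugeDeriv s) + log 2

lemma angleExcess_eq (s : ℝ) : angleExcess s = log (1 + (π / 2 - s) ^ 2 / 50) := by
  rw [angleExcess, ← log_mul (angleGaugeDeriv_pos s).ne' two_ne_zero, angleGaugeDeriv]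
  ring_nf

lemma angleExcess_nonneg (s : ℝ) : 0 ≤ angleExcess s := by
  rw [angleExcess_eq]
  exact log_nonneg (by linarith [sq_nonneg (π / 2 - s)])

lemma integrable_angleExcess (ν : Measure RhombusAngle) [IsProbabilityMeasure ν] :
    Integrable (fun p : RhombusAngle => angleExcess p) ν :=
  (integrable_log_angleGaugeDeriv ν).add (integrable_const _)

lemma IsFreeEnergyMinimizer.integral_angleExcess_le {b B : ℝ} (hb : 0 < b)
    {f g : Density uniformAngle} (hg : IsFreeEnergyMinimizer rhombusKernel b g)
    (hf : freeEnergy rhombusKernel b f ≤ (B : EReal)) :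
    ∫ p : RhombusAngle, angleExcess p ∂g.state ≤
      B - (log b + log (π / 2) - 1 - log 2) := by
  have h := (hg f).trans hf
  have hint : Integrable (freeEnergyIntegrand rhombusKernel b g) uniformAngle := by
    -- A nonintegrable integrand would give energy `⊤`, above the finite bound `B`.
    by_contra hn
    rw [freeEnergy, if_neg hn] at h
    exact absurd h (by simp)
  rw [freeEnergy, if_pos hint, EReal.coe_le_coe_iff] at h
  have hlb := le_integral_freeEnergyIntegrand g hb ((integrable_freeEnergyIntegrand_iff g b).1 hint)
  simp only [angleExcess]
  rw [integral_add (integrable_log_angleGaugeDeriv _) (integrable_const _), integral_const,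
    probReal_univ, one_smul]
  linarith

lemma tendsto_integral_angleExcess {ι : Type*} {l : Filter ι} {b : ι → ℝ}
    {g : ι → Density uniformAngle} (hb : Tendsto b l atTop)
    (hg : ∀ᶠ i in l, IsFreeEnergyMinimizer rhombusKernel (b i) (g i)) :
    Tendsto (fun i => ∫ p : RhombusAngle, angleExcess p ∂(g i).state) l (𝓝 0) := by
  rw [Metric.tendsto_nhds]
  intro η hη
  have hlim : Tendsto (fun δ : ℝ => 2 * ((1 + δ) * log (1 + δ) - δ * log δ)) (𝓝[>] 0) (𝓝 0) := by
    have hc : Continuous fun δ : ℝ => 2 * ((1 + δ) * log (1 + δ) - δ * log δ) := by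
      have h1 : Continuous fun δ : ℝ => (1 + δ) * log (1 + δ) :=
        continuous_mul_log.comp (continuous_const.add continuous_id)
      have h2 : Continuous fun δ : ℝ => δ * log δ := continuous_mul_log
      exact (h1.sub h2).const_mul 2
    have := hc.tendsto 0
    simp only [add_zero, log_one, mul_zero, zero_mul, sub_zero] at this
    exact this.mono_left nhdsWithin_le_nhds
  -- The width `L` depends on `δ`, so `δ` is fixed first to make the entropy defect small, and only
  -- then is `b` taken large to absorb `10 L / b`.
  obtain ⟨δ, hδη, hδ⟩ := ((hlim.eventually (gt_mem_nhds (half_pos hη))).and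
    self_mem_nhdsWithin).exists
  obtain ⟨L, hL, hLf⟩ := exists_freeEnergy_le (hδ : 0 < δ)
  filter_upwards [hg, hb.eventually_gt_atTop 0, hb.eventually_ge_atTop (2 * L),
    hb.eventually_gt_atTop (20 * L / η)] with i hgi hbi hbL hbη
  obtain ⟨f, hf⟩ := hLf (b i) hbi (((div_le_one hbi).2 hbL).trans (by linarith [pi_gt_three]))
  have h := hgi.integral_angleExcess_le hbi hf
  have h0 : 0 ≤ ∫ p : RhombusAngle, angleExcess p ∂(g i).state :=
    integral_nonneg fun p => angleExcess_nonneg p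
  have hLb : 10 * L / b i < η / 2 := by
    rw [div_lt_iff₀ hη] at hbη
    rw [div_lt_iff₀ hbi]
    linarith
  rw [dist_zero_right, norm_eq_abs, abs_of_nonneg h0]
  linarith

/-- Near the square continuity gives `ε`; away from it the excess is bounded below by a positive
constant, so a multiple of it dominates the bounded oscillation of `h`. This is what turns decay of
the mean excess into weak convergence. -/
lemma exists_abs_sub_le_add_angleExcess (h : RhombusAngle → ℝ) (hc : Continuous h) {ε : ℝ}
    (hε : 0 < ε) :
    ∃ C ≥ 0, ∀ p, |h p - h squareAngle| ≤ ε + C * angleExcess p := by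
  obtain ⟨r, hr, hball⟩ := Metric.continuousAt_iff.1 (hc.continuousAt (x := squareAngle)) ε hε
  obtain ⟨D, hD⟩ := (isCompact_range (hc.sub continuous_const).abs :
    IsCompact (Set.range fun p => |h p - h squareAngle|)).bddAbove
  have hD' : ∀ p, |h p - h squareAngle| ≤ D := fun p => hD ⟨p, rfl⟩
  have hD0 : 0 ≤ D := (abs_nonneg _).trans (hD' squareAngle)
  set m := log (1 + r ^ 2 / 50) with hm
  have hm0 : 0 < m := log_pos (by linarith [pow_pos hr 2])
  refine ⟨D / m, by positivity, fun p => ?_⟩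
  have hex := angleExcess_nonneg p
  rcases lt_or_ge (dist p squareAngle) r with hp | hp
  · have h1 : |h p - h squareAngle| < ε := hball hp
    have : 0 ≤ D / m * angleExcess p := by positivity
    linarith
  · have h0 : 0 ≤ π / 2 - (p : ℝ) := sub_nonneg.2 p.2.2
    have h1 : r ≤ π / 2 - (p : ℝ) := by
      rw [Subtype.dist_eq, dist_comm, Real.dist_eq] at hp
      exact hp.trans_eq (abs_of_nonneg h0)
    have h2 : m ≤ angleExcess p := by
      rw [angleExcess_eq, hm]
      gcongr
    calc |h p - h squareAngle| ≤ D := hD' p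
      _ = D / m * m := by field_simp
      _ ≤ D / m * angleExcess p := by gcongr
      _ ≤ ε + D / m * angleExcess p := by linarith

lemma tendsto_state_of_minimizers {ι : Type*} {l : Filter ι} {b : ι → ℝ}
    {g : ι → Density uniformAngle} (hb : Tendsto b l atTop)
    (hg : ∀ᶠ i in l, IsFreeEnergyMinimizer rhombusKernel (b i) (g i)) :
    Tendsto (fun i => (g i).toProbabilityMeasure) l (𝓝 (diracProba squareAngle)) := by
  rw [ProbabilityMeasure.tendsto_iff_forall_integral_tendsto]
  intro h
  have hdirac : ∫ p, h p ∂((diracProba squareAngle : ProbabilityMeasure RhombusAngle) :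
      Measure RhombusAngle) = h squareAngle := by
    change ∫ p, h p ∂(Measure.dirac squareAngle) = h squareAngle
    exact integral_dirac _ _
  rw [hdirac, Metric.tendsto_nhds]
  intro ε hε
  obtain ⟨C, hC, hle⟩ := exists_abs_sub_le_add_angleExcess h h.continuous (half_pos hε)
  have hlim := (tendsto_integral_angleExcess hb hg).const_mul C
  rw [mul_zero] at hlim
  filter_upwards [hlim.eventually (gt_mem_nhds (half_pos hε))] with i hi
  have hhi : Integrable h (g i).state := h.integrable _
  have hexc := (integrable_angleExcess (g i).state).const_mul C
  have e : ∫ p, h p ∂(g i).state - h squareAngle =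
      ∫ p, (h p - h squareAngle) ∂(g i).state := by
    rw [integral_sub hhi (integrable_const _), integral_const, probReal_univ, one_smul]
  have hmono : ∫ p, |h p - h squareAngle| ∂(g i).state ≤
      ∫ p : RhombusAngle, (ε / 2 + C * angleExcess p) ∂(g i).state :=
    integral_mono (hhi.sub (integrable_const _)).abs ((integrable_const _).add hexc) hle
  rw [integral_add (integrable_const _) hexc, integral_const, probReal_univ, one_smul,
    integral_const_mul] at hmono
  rw [Real.dist_eq]
  change |∫ p, h p ∂(g i).state - h squareAngle| < ε
  rw [e]
  have := abs_integral_le_integral_abs (f := fun p => h p - h squareAngle) (μ := (g i).state)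
  linarith

theorem mainTheorem5 :
    (∀ p : RhombusAngle, rhombusKernel p p = 0) ∧
    (∀ p q : RhombusAngle, p ≠ q →
      rhombusKernel p q =
        8 * (sin (|(p : ℝ) - q| / 4) ^ 2 / sin (|(p : ℝ) - q| / 2)) *
          (sin (((p : ℝ) + q) / 4) ^ 2 * sin ((p : ℝ) / 2) * sin ((q : ℝ) / 2) +
            cos (((p : ℝ) + q) / 4) ^ 2 * cos ((p : ℝ) / 2) * cos ((q : ℝ) / 2))) ∧
    (∃ C : ℝ, ∀ p q : RhombusAngle, ∀ ε : ℝ, 0 ≤ ε → (q : ℝ) = p + ε →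
      |rhombusKernel p q - ε * (sin ((p : ℝ) / 2) ^ 4 + cos ((p : ℝ) / 2) ^ 4)| ≤ C * ε ^ 2) ∧
    (∀ {ι : Type*} (l : Filter ι) (b : ι → ℝ) (g : ι → Density uniformAngle),
      Tendsto b l atTop →
      (∀ᶠ i in l, IsFreeEnergyMinimizer rhombusKernel (b i) (g i)) →
      Tendsto (fun i => (g i).toProbabilityMeasure) l (𝓝 (diracProba squareAngle))) :=
  ⟨rhombusKernel_self, fun _ _ => rhombusKernel_formula,
    ⟨2, fun _ _ _ => abs_rhombusKernel_sub_le⟩, fun _ _ _ => tendsto_state_of_minimizers⟩
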